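/- Let $m,n$ be positive integers with $\gcd(m,n)=1$ and let $\mathbb H=\mathbb H_{m/n}=\{(z_1,z_2)\in\mathbb C^2:\ |z_1|^{m/n}<|z_2|<1\}$, with Lebesgue measure $dV$. For $0<p<\infty$ let $A^p(\mathbb H)$ be the space of holomorphic functions on $\mathbb H$ that belong to $L^p(\mathbb H)$. For $\alpha\in\mathbb Z^2$ put $e_\alpha(z)=z_1^{\alpha_1}z_2^{\alpha_2}$, and for $r\ge 2$ let $\mathcal S(\mathbb H,L^r)=\{\alpha\in\mathbb Z^2: e_\alpha\in A^r(\mathbb H)\}$. The $L^r$ sub-Bergman projection is the integral operator $$\widetilde{\boldsymbol B^r}f(z)=\int_{\mathbb H}\widetilde{B^r}(z,w)f(w)\,dV(w),\qquad \widetilde{B^r}(z,w)=\sum_{\alpha\in\mathcal S(\mathbb H,L^r)}\frac{e_\alpha(z)\overline{e_\alpha(w)}}{\|e_\alpha\|_{L^2(\mathbb H)}^2}.$$ For integers $k\le 0$ put $p_k=\frac{2m+2n}{1-k}$, and put $p_1=\infty$. (1) Let $2\le p<r<\infty$ and $f\in A^p(\mathbb H)$. Then the series defining $\widetilde{B^r}(z,w)$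 converges absolutely for all $z,w\in\mathbb H$, the integral defining $\widetilde{\boldsymbol B^r}f(z)$ converges absolutely for every $z\in\mathbb H$, and there is a sequence of functions in $A^r(\mathbb H)$ converging to $f$ in the $L^p(\mathbb H)$ norm if and only if $\widetilde{\boldsymbol B^r}f=f$ on $\mathbb H$. (2) Let $1<p<2$, let $p'$ be the exponent conjugate to $p$, let $k\in\{1-2m-2n,\dots,-1,0\}$ be such that $p'<p_{k+1}$, let $r\in[p_k,p_{k+1})$ (then $r\ge 2$), and let $f\in A^p(\mathbb H)$. Then the series and the integrals converge as in (1), and there is a sequence of functions in $A^r(\mathbb H)$ converging to $f$ in the $L^p(\mathbb H)$ norm if and only if $\widetilde{\boldsymbol B^r}f=f$ on $\mathbb H$. -/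

import Mathlib

open MeasureTheory Filter Topology
open scoped ENNReal ComplexConjugate

noncomputable section

/-- The power-generalized Hartogs triangle of exponent `γ`:
`{(z₁, z₂) ∈ ℂ² : |z₁| ^ γ < |z₂| < 1}`. -/
def hartogsTriangle (γ : ℝ) : Set (ℂ × ℂ) :=
  {z | ‖z.1‖ ^ γ < ‖z.2‖ ∧ ‖z.2‖ < 1}

/-- The Bergman space `A^p(Ω) = 𝒪(Ω) ∩ L^p(Ω)`, for Lebesgue measure on `ℂ²` and a real exponent
`0 < p < ∞`. Only the values on `Ω` matter. -/
def bergmanSpace (Ω : Set (ℂ × ℂ)) (p : ℝ) : Set (ℂ × ℂ → ℂ) :=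
  {f | DifferentiableOn ℂ f Ω ∧ MemLp f (ENNReal.ofReal p) (volume.restrict Ω)}

/-- The Laurent monomial `e_α(z) = z₁ ^ α₁ * z₂ ^ α₂`, for `α ∈ ℤ²`. -/
def monom (α : ℤ × ℤ) (z : ℂ × ℂ) : ℂ :=
  z.1 ^ α.1 * z.2 ^ α.2

/-- The `L^p`-allowable multi-indices `𝒮(Ω, L^p) = {α ∈ ℤ² : e_α ∈ A^p(Ω)}`. If `Ω` has a point
with `z₁ = 0`, then `α₁ < 0` is excluded: the function `monom α` is not differentiable there. -/
def allowable (Ω : Set (ℂ × ℂ)) (p : ℝ) : Set (ℤ × ℤ) :=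
  {α | monom α ∈ bergmanSpace Ω p}

/-- The squared norm `‖e_α‖₂²` in `L²(Ω)`. -/
def monomNormSq (Ω : Set (ℂ × ℂ)) (α : ℤ × ℤ) : ℝ :=
  ∫ w in Ω, ‖monom α w‖ ^ 2

/-- The summand `e_α(z) * conj (e_α(w)) / ‖e_α‖₂²` of the sub-Bergman kernel. -/
def subBergmanTerm (Ω : Set (ℂ × ℂ)) (z w : ℂ × ℂ) (α : ℤ × ℤ) : ℂ :=
  monom α z * conj (monom α w) / (monomNormSq Ω α : ℂ)

/-- The `L^r` sub-Bergman kernel (`r ≥ 2`): the sum of `e_α(z) * conj (e_α(w)) / ‖e_α‖₂²` over the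
`L^r`-allowable multi-indices. -/
def subBergmanKernel (Ω : Set (ℂ × ℂ)) (r : ℝ) (z w : ℂ × ℂ) : ℂ :=
  ∑' α : allowable Ω r, subBergmanTerm Ω z w α

/-- The `L^r` sub-Bergman projection, as an integral operator. -/
def subBergman (Ω : Set (ℂ × ℂ)) (r : ℝ) (f : ℂ × ℂ → ℂ) (z : ℂ × ℂ) : ℂ :=
  ∫ w in Ω, subBergmanKernel Ω r z w * f w

/-- The sub-Bergman projection of `f` is well defined at every point of `Ω`: the series of the
kernel converges absolutely on `Ω × Ω`, and the integral converges for each `z ∈ Ω`. -/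
def SubBergmanConverges (Ω : Set (ℂ × ℂ)) (r : ℝ) (f : ℂ × ℂ → ℂ) : Prop :=
  (∀ z ∈ Ω, ∀ w ∈ Ω, Summable fun α : allowable Ω r => subBergmanTerm Ω z w α) ∧
    ∀ z ∈ Ω, IntegrableOn (fun w => subBergmanKernel Ω r z w * f w) Ω

/-- `f` is the limit in `L^p(Ω)` of a sequence of functions in `A^r(Ω)`. -/
def ApproxByBergman (Ω : Set (ℂ × ℂ)) (p r : ℝ) (f : ℂ × ℂ → ℂ) : Prop :=
  ∃ g : ℕ → ℂ × ℂ → ℂ, (∀ j, g j ∈ bergmanSpace Ω r) ∧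
    Tendsto (fun j => eLpNorm (g j - f) (ENNReal.ofReal p) (volume.restrict Ω)) atTop (𝓝 0)

/-- The threshold `p_k = (2m + 2n) / (1 - k)`, for an integer `k ≤ 1`; here `p_1 = ∞`. -/
def threshold (m n : ℕ) (k : ℤ) : ℝ≥0∞ :=
  ENNReal.ofReal (2 * (m : ℝ) + 2 * (n : ℝ)) / ENNReal.ofReal (1 - (k : ℝ))

end

/-! The map $(u,v)\mapsto(uv^n,v^m)$ covers $\mathbb H_{m/n}$ by $\mathbb D\times\mathbb D^*$, and
$|e_\alpha|=|u|^{\alpha_1}|v|^{w}$ with $w=n\alpha_1+m\alpha_2$. Hence $e_\alpha\in A^r$ exactly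
when $\alpha_1\ge0$ and $rw+2n+2m>0$. Everything is governed by the least integer $k$ with
$rk+2n+2m>0$; for $k\le0$ this says $p_k\le r<p_{k+1}$.

Since allowable weights are at least $k$, geometric series bound the kernel by $C|v(z)|^k|v(w)|^k$
for $|u(z)|,|v(z)|\le\rho<1$ and all $w$ (`exists_norm_subBergmanKernel_le`). If also $p'k+2n+2m>0$,
then $|v|^k\in L^{p'}$, so Hölder gives convergence on $L^p$, and the value of the projection at
each point depends continuously on $f$ in $L^p$.

The projection fixes $A^r$ (`subBergman_eq_self`): averaging against torus characters isolates the
Laurent terms of $g$, each again in $L^r$. Only allowable terms survive, the kernel reproduces them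
one by one, and Fourier inversion sums them to $g$. Passing to an $L^p$ limit, every limit of $A^r$
functions is fixed.

Conversely, a fixed $f$ satisfies $|f|\le C|v|^k$ wherever $|u|,|v|\le\rho$. Its dilates, which
shrink both radii, are therefore dominated by $|v|^k\in L^r$ and lie in $A^r$. They tend to $f$ in
$L^p$ because they converge pointwise and their norms do not asymptotically exceed that of $f$
(`tendsto_lintegral_enorm_sub_rpow`). -/

/-! ### Radial coordinates and dilations -/

/-- The inner coordinate `|v| = |z₂| ^ (1 / m)` of the covering `(u, v) ↦ (u * v ^ n, v ^ m)` of the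
Hartogs triangle of exponent `m / n` by `𝔻 × 𝔻*`. -/
noncomputable def fiberRadius (m : ℕ) (z : ℂ × ℂ) : ℝ := ‖z.2‖ ^ ((m : ℝ)⁻¹)

/-- The outer coordinate `|u| = |z₁| / |v| ^ n` of the covering `(u, v) ↦ (u * v ^ n, v ^ m)` of the
Hartogs triangle of exponent `m / n` by `𝔻 × 𝔻*`. -/
noncomputable def baseRadius (m n : ℕ) (z : ℂ × ℂ) : ℝ := ‖z.1‖ / fiberRadius m z ^ n

/-- The weight of a multi-index under `(z₁, z₂) ↦ (t ^ n * z₁, t ^ m * z₂)`. -/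
def weight (m n : ℕ) (α : ℤ × ℤ) : ℤ := n * α.1 + m * α.2

theorem fiberRadius_nonneg (m : ℕ) (z : ℂ × ℂ) : 0 ≤ fiberRadius m z := by
  unfold fiberRadius; positivity

theorem baseRadius_nonneg (m n : ℕ) (z : ℂ × ℂ) : 0 ≤ baseRadius m n z :=
  div_nonneg (norm_nonneg _) (pow_nonneg (fiberRadius_nonneg m z) _)

theorem fiberRadius_pow {m : ℕ} (hm : 0 < m) (z : ℂ × ℂ) : fiberRadius m z ^ m = ‖z.2‖ :=
  Real.rpow_inv_natCast_pow (norm_nonneg _) hm.ne'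

theorem continuous_fiberRadius (m : ℕ) : Continuous (fiberRadius m) := by
  unfold fiberRadius
  exact (continuous_norm.comp continuous_snd).rpow_const fun _ => Or.inr (by positivity)

theorem measurable_baseRadius (m n : ℕ) : Measurable (baseRadius m n) := by
  unfold baseRadius
  exact (measurable_norm.comp measurable_fst).div
    ((continuous_fiberRadius m).measurable.pow_const n)

theorem mem_hartogsTriangle_iff {m n : ℕ} (hm : 0 < m) (hn : 0 < n) {z : ℂ × ℂ} :
    z ∈ hartogsTriangle ((m : ℝ) / n) ↔
      0 < fiberRadius m z ∧ fiberRadius m z < 1 ∧ baseRadius m n z < 1 := by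
  have hm' : (0 : ℝ) < m := by exact_mod_cast hm
  have hn' : (0 : ℝ) < n := by exact_mod_cast hn
  have h1 : fiberRadius m z < 1 ↔ ‖z.2‖ < 1 := by
    rw [← fiberRadius_pow hm z, pow_lt_one_iff_of_nonneg (fiberRadius_nonneg m z) hm.ne']
  have h0 : 0 < fiberRadius m z ↔ 0 < ‖z.2‖ := by
    rw [← fiberRadius_pow hm z]
    exact ⟨fun h => pow_pos h m, fun h => (fiberRadius_nonneg m z).lt_of_ne'
      fun h' => by simp [h', hm.ne'] at h⟩
  have h2 : ‖z.1‖ ^ ((m : ℝ) / n) < ‖z.2‖ ↔ ‖z.1‖ < fiberRadius m z ^ n := by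
    have e : ‖z.2‖ = (fiberRadius m z ^ n) ^ ((m : ℝ) / n) := by
      rw [← Real.rpow_natCast, ← Real.rpow_mul (fiberRadius_nonneg m z), mul_div_cancel₀ _ hn'.ne',
        Real.rpow_natCast, fiberRadius_pow hm]
    rw [e, Real.rpow_lt_rpow_iff (norm_nonneg _) (pow_nonneg (fiberRadius_nonneg m z) _)
      (by positivity)]
  constructor
  · rintro ⟨ha, hb⟩
    have hs : 0 < fiberRadius m z :=
      h0.2 (lt_of_le_of_lt (Real.rpow_nonneg (norm_nonneg _) _) ha)
    exact ⟨hs, h1.2 hb, (div_lt_one (pow_pos hs n)).2 (h2.1 ha)⟩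
  · rintro ⟨hs, hb, hc⟩
    exact ⟨h2.2 ((div_lt_one (pow_pos hs n)).1 hc), h1.1 hb⟩

theorem isOpen_hartogsTriangle_of_nonneg {γ : ℝ} (hγ : 0 ≤ γ) : IsOpen (hartogsTriangle γ) := by
  refine IsOpen.inter (isOpen_lt ?_ continuous_snd.norm)
    (isOpen_lt continuous_snd.norm continuous_const)
  exact (continuous_norm.comp continuous_fst).rpow_const fun _ => Or.inr hγ

theorem isOpen_hartogsTriangle {m n : ℕ} : IsOpen (hartogsTriangle ((m : ℝ) / n)) :=
  isOpen_hartogsTriangle_of_nonneg (by positivity)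

theorem norm_fst_eq {m n : ℕ} {z : ℂ × ℂ} (hz : 0 < fiberRadius m z) :
    ‖z.1‖ = baseRadius m n z * fiberRadius m z ^ n :=
  (div_mul_cancel₀ _ (pow_pos hz n).ne').symm

theorem norm_monom {m n : ℕ} (hm : 0 < m) {z : ℂ × ℂ} (hz : 0 < fiberRadius m z) (α : ℤ × ℤ) :
    ‖monom α z‖ = baseRadius m n z ^ α.1 * fiberRadius m z ^ weight m n α := by
  rw [monom, norm_mul, norm_zpow, norm_zpow, norm_fst_eq (n := n) hz, ← fiberRadius_pow hm,
    mul_zpow,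
    weight, zpow_add₀ hz.ne', zpow_mul, zpow_mul, zpow_natCast, zpow_natCast, mul_assoc]

theorem volume_hartogsTriangle_lt_top {m n : ℕ} (hm : 0 < m) (hn : 0 < n) :
    volume (hartogsTriangle ((m : ℝ) / n)) < ∞ := by
  refine lt_of_le_of_lt (measure_mono (t := Metric.ball (0 : ℂ) 1 ×ˢ Metric.ball (0 : ℂ) 1) ?_) ?_
  · intro z hz
    obtain ⟨h0, h1, h2⟩ := (mem_hartogsTriangle_iff hm hn).1 hz
    refine ⟨?_, by simpa using hz.2⟩
    rw [mem_ball_zero_iff, norm_fst_eq (n := n) h0]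
    calc _ ≤ baseRadius m n z * 1 := by
          gcongr
          · exact baseRadius_nonneg m n z
          · exact pow_le_one₀ h0.le h1.le
      _ < 1 := by simpa using h2
  · rw [Measure.volume_eq_prod, Measure.prod_prod]
    exact ENNReal.mul_lt_top Metric.isBounded_ball.measure_lt_top
      Metric.isBounded_ball.measure_lt_top

theorem measurable_monom (α : ℤ × ℤ) : Measurable (monom α) := by
  unfold monom
  exact (measurable_fst.pow_const _).mul (measurable_snd.pow_const _)

/-- The dilation `(z₁, z₂) ↦ (ρ ^ (n + 1) * z₁, ρ ^ m * z₂)`, which multiplies both radial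
coordinates by `ρ`. -/
noncomputable def dilate (m n : ℕ) (ρ : ℝ) (z : ℂ × ℂ) : ℂ × ℂ :=
  ((ρ ^ (n + 1) : ℝ) • z.1, (ρ ^ m : ℝ) • z.2)

theorem fiberRadius_dilate {m : ℕ} (hm : 0 < m) (n : ℕ) {ρ : ℝ} (hρ : 0 < ρ) (z : ℂ × ℂ) :
    fiberRadius m (dilate m n ρ z) = ρ * fiberRadius m z := by
  rw [fiberRadius, fiberRadius, dilate, norm_smul, Real.norm_of_nonneg (by positivity),
    Real.mul_rpow (by positivity) (norm_nonneg _), Real.pow_rpow_inv_natCast hρ.le hm.ne']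

theorem baseRadius_dilate {m : ℕ} (hm : 0 < m) (n : ℕ) {ρ : ℝ} (hρ : 0 < ρ) (z : ℂ × ℂ) :
    baseRadius m n (dilate m n ρ z) = ρ * baseRadius m n z := by
  rw [baseRadius, baseRadius, fiberRadius_dilate hm n hρ, dilate, norm_smul,
    Real.norm_of_nonneg (by positivity), mul_pow, pow_succ]
  have : ρ ^ n ≠ 0 := by positivity
  rw [mul_assoc, mul_div_mul_left _ _ this, mul_div_assoc]

theorem dilate_mem {m n : ℕ} (hm : 0 < m) (hn : 0 < n) {ρ : ℝ} (h0 : 0 < ρ) (h1 : ρ < 1)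
    {z : ℂ × ℂ} (hz : z ∈ hartogsTriangle ((m : ℝ) / n)) :
    dilate m n ρ z ∈ hartogsTriangle ((m : ℝ) / n) := by
  rw [mem_hartogsTriangle_iff hm hn] at hz ⊢
  rw [fiberRadius_dilate hm n h0, baseRadius_dilate hm n h0]
  exact ⟨mul_pos h0 hz.1, mul_lt_one_of_nonneg_of_lt_one_left h0.le h1 hz.2.1.le,
    mul_lt_one_of_nonneg_of_lt_one_left h0.le h1 hz.2.2.le⟩

/-! ### Integrability of radial powers and allowable monomials -/

theorem lintegral_norm_rpow_unitBall_lt_top_iff {y : ℝ} :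
    ∫⁻ w in Metric.ball (0 : ℂ) 1, ENNReal.ofReal (‖w‖ ^ y) < ∞ ↔ -2 < y := by
  have h1 : IntegrableOn (fun w : ℂ => ‖w‖ ^ y) (Metric.ball 0 1) ↔ -2 < y := by
    rw [integrableOn_fun_norm_addHaar volume (f := fun t : ℝ => t ^ y), Complex.finrank_real_complex,
      integrableOn_congr_fun (g := fun t : ℝ => t ^ (y + 1)) _ measurableSet_Ioo,
      intervalIntegral.integrableOn_Ioo_rpow_iff one_pos]
    · constructor <;> intro h <;> linarith
    · intro t ht
      simp [Real.rpow_add_one ht.1.ne', mul_comm]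
  rw [← h1, IntegrableOn, Integrable, hasFiniteIntegral_iff_ofReal
    (Eventually.of_forall fun w => by positivity)]
  refine (and_iff_right ?_).symm
  exact (measurable_norm.pow_const y).aestronglyMeasurable

theorem volume_annulus {a s : ℝ} (ha : 0 ≤ a) (ha1 : a < 1) (hs : 0 ≤ s) :
    volume {x : ℂ | a * s ≤ ‖x‖ ∧ ‖x‖ < s} =
      ENNReal.ofReal (s ^ 2) * (ENNReal.ofReal (1 - a ^ 2) * NNReal.pi) := by
  have : {x : ℂ | a * s ≤ ‖x‖ ∧ ‖x‖ < s} = Metric.ball 0 s \ Metric.ball 0 (a * s) := by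
    ext x; simp [and_comm]
  rw [this, measure_sdiff (Metric.ball_subset_ball (mul_le_of_le_one_left hs ha1.le))
    measurableSet_ball.nullMeasurableSet Metric.isBounded_ball.measure_lt_top.ne,
    Complex.volume_ball, Complex.volume_ball, ← mul_assoc, ← ENNReal.sub_mul (by simp),
    ← ENNReal.ofReal_pow hs, ← ENNReal.ofReal_pow (by positivity),
    ← ENNReal.ofReal_sub _ (by positivity), ← ENNReal.ofReal_mul (by positivity)]
  congr 2; ring_nf

/-- The slice over $z_2=w$ is an annulus of area proportional to $|v|^{2n}=|w|^{2n/m}$, so Tonelli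
leaves the integral of $|w|^{(y+2n)/m}$ over the unit disc. The cutoff $a$ serves both directions:
$a=0$ gives the whole domain, $a=1/2$ a region on which $|u|$ is bounded below. -/
theorem lintegral_fiberRadius_rpow_lt_top_iff {m n : ℕ} (hm : 0 < m) (hn : 0 < n) {a : ℝ}
    (ha : 0 ≤ a) (ha1 : a < 1) (y : ℝ) :
    ∫⁻ z in hartogsTriangle ((m : ℝ) / n) ∩ {z | a ≤ baseRadius m n z},
      ENNReal.ofReal (fiberRadius m z ^ y) < ∞ ↔ 0 < y + 2 * n + 2 * m := by
  have hm' : (0 : ℝ) < m := by exact_mod_cast hm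
  have hE : MeasurableSet (hartogsTriangle ((m : ℝ) / n) ∩ {z | a ≤ baseRadius m n z}) :=
    isOpen_hartogsTriangle.measurableSet.inter (measurableSet_le measurable_const
      (measurable_baseRadius m n))
  set C : ℝ≥0∞ := ENNReal.ofReal (1 - a ^ 2) * NNReal.pi with hC
  have hC0 : C ≠ 0 := by
    have : 0 < 1 - a ^ 2 := by nlinarith
    exact mul_ne_zero (by simpa only [ne_eq, ENNReal.ofReal_eq_zero, not_le] using this)
      (by simp [NNReal.pi_ne_zero])
  have hCt : C ≠ ∞ := by simp [hC, ENNReal.mul_eq_top]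
  have key : ∫⁻ z in hartogsTriangle ((m : ℝ) / n) ∩ {z | a ≤ baseRadius m n z},
      ENNReal.ofReal (fiberRadius m z ^ y) =
      (∫⁻ w in Metric.ball (0 : ℂ) 1, ENNReal.ofReal (‖w‖ ^ ((y + 2 * n) / m))) * C := by
    rw [← lintegral_indicator hE, Measure.volume_eq_prod, lintegral_prod_symm', ←
      lintegral_mul_const' _ _ hCt, ← lintegral_indicator measurableSet_ball]
    · have h0 : ∀ᵐ w : ℂ, w ≠ 0 := by simp [ae_iff]
      refine lintegral_congr_ae (h0.mono fun w hw => ?_)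
      have hpos : ∀ x : ℂ, 0 < fiberRadius m (x, w) := fun x =>
        Real.rpow_pos_of_pos (norm_pos_iff.2 hw) _
      by_cases hw1 : w ∈ Metric.ball (0 : ℂ) 1
      · rw [Set.indicator_of_mem hw1]
        have hlt : ∀ x : ℂ, fiberRadius m (x, w) < 1 := fun x =>
          Real.rpow_lt_one (norm_nonneg _) (by simpa using hw1) (by positivity)
        set s : ℝ := ‖w‖ ^ ((m : ℝ)⁻¹) with hs
        have hs0 : 0 < s := hpos 0
        have e : ∀ x : ℂ, (hartogsTriangle ((m : ℝ) / n) ∩ {z | a ≤ baseRadius m n z}).indicator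
            (fun z => ENNReal.ofReal (fiberRadius m z ^ y)) (x, w) =
            {x : ℂ | a * s ^ n ≤ ‖x‖ ∧ ‖x‖ < s ^ n}.indicator
              (fun _ => ENNReal.ofReal (s ^ y)) x := by
          intro x
          refine Set.indicator_eq_indicator ?_ rfl
          have hsn : 0 < s ^ n := pow_pos hs0 n
          simp only [Set.mem_inter_iff, mem_hartogsTriangle_iff hm hn, hpos x, hlt x, true_and,
            Set.mem_ofPred_eq]
          change ‖x‖ / s ^ n < 1 ∧ a ≤ ‖x‖ / s ^ n ↔ _
          rw [div_lt_one hsn, le_div_iff₀ hsn, and_comm]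
        have hmeas : MeasurableSet {x : ℂ | a * s ^ n ≤ ‖x‖ ∧ ‖x‖ < s ^ n} :=
          (measurableSet_le measurable_const measurable_norm).inter
            (measurableSet_lt measurable_norm measurable_const)
        simp only [e]
        rw [lintegral_indicator hmeas, setLIntegral_const, volume_annulus ha ha1 (by positivity),
          ← mul_assoc, ← ENNReal.ofReal_mul (by positivity)]
        congr 2
        rw [← pow_mul, ← Real.rpow_natCast, ← Real.rpow_add hs0, hs, ← Real.rpow_mul (norm_nonneg _)]
        congr 1
        push_cast
        field_simp
      · rw [Set.indicator_of_notMem hw1]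
        refine (lintegral_congr fun x => ?_).trans lintegral_zero
        refine Set.indicator_of_notMem (fun h => hw1 ?_) _
        simpa using h.1.2
    · exact ((continuous_fiberRadius m).measurable.pow_const y).ennreal_ofReal.indicator hE
  rw [key, ENNReal.mul_lt_top_iff]
  simp only [hCt.lt_top, and_true, hC0, or_false]
  rw [or_iff_left_of_imp (fun h => by simp [h]), lintegral_norm_rpow_unitBall_lt_top_iff,
    lt_div_iff₀ hm']
  constructor <;> intro h <;> linarith

theorem memLp_fiberRadius_zpow {m n : ℕ} (hm : 0 < m) (hn : 0 < n) {q : ℝ} (hq : 0 < q) {k : ℤ}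
    (h : 0 < q * k + 2 * n + 2 * m) :
    MemLp (fun z => fiberRadius m z ^ k) (ENNReal.ofReal q)
      (volume.restrict (hartogsTriangle ((m : ℝ) / n))) := by
  refine ⟨((continuous_fiberRadius m).measurable.pow_const k).aestronglyMeasurable, ?_⟩
  rw [eLpNorm_lt_top_iff_lintegral_rpow_enorm_lt_top (by simpa using hq) ENNReal.ofReal_ne_top,
    ENNReal.toReal_ofReal hq.le]
  have := (lintegral_fiberRadius_rpow_lt_top_iff hm hn le_rfl one_pos (q * k)).2 h
  have e : hartogsTriangle ((m : ℝ) / n) ∩ {z | 0 ≤ baseRadius m n z} =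
      hartogsTriangle ((m : ℝ) / n) :=
    Set.inter_eq_left.2 fun z _ => baseRadius_nonneg m n z
  rw [e] at this
  refine lt_of_eq_of_lt (lintegral_congr fun z => ?_) this
  have h0 := fiberRadius_nonneg m z
  rw [Real.enorm_of_nonneg (by positivity), ENNReal.ofReal_rpow_of_nonneg (by positivity) hq.le,
    mul_comm, Real.rpow_mul h0, Real.rpow_intCast]

/-- On $|u|\ge1/2$ the factor $|u|^{\alpha_1}$ is bounded below, so integrability of $|e_\alpha|^q$
forces that of $|v|^{qw}$ there. -/
theorem weight_of_memLp_monom {m n : ℕ} (hm : 0 < m) (hn : 0 < n) {q : ℝ} (hq : 0 < q)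
    {α : ℤ × ℤ} (hα : 0 ≤ α.1)
    (h : MemLp (monom α) (ENNReal.ofReal q) (volume.restrict (hartogsTriangle ((m : ℝ) / n)))) :
    0 < q * weight m n α + 2 * n + 2 * m := by
  have h2 := h.2
  rw [eLpNorm_lt_top_iff_lintegral_rpow_enorm_lt_top (by simpa using hq) ENNReal.ofReal_ne_top,
    ENNReal.toReal_ofReal hq.le] at h2
  rw [← lintegral_fiberRadius_rpow_lt_top_iff hm hn (a := 1 / 2) (by norm_num) (by norm_num)]
  set E := hartogsTriangle ((m : ℝ) / n) ∩ {z | 1 / 2 ≤ baseRadius m n z}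
  have hE : MeasurableSet E :=
    isOpen_hartogsTriangle.measurableSet.inter (measurableSet_le measurable_const
      (measurable_baseRadius m n))
  set c : ℝ := ((1 / 2 : ℝ) ^ α.1) ^ q
  have hc : 0 < c := by positivity
  have h3 : ENNReal.ofReal c *
      ∫⁻ z in E, ENNReal.ofReal (fiberRadius m z ^ (q * weight m n α)) < ∞ := by
    rw [← lintegral_const_mul' _ _ ENNReal.ofReal_ne_top]
    refine lt_of_le_of_lt ?_ ((lintegral_mono_set (μ := volume)
      (Set.inter_subset_left : E ⊆ _)).trans_lt h2)
    refine setLIntegral_mono' hE fun z hz => ?_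
    have h0 := ((mem_hartogsTriangle_iff hm hn).1 hz.1).1
    have hb : (1 / 2 : ℝ) ^ α.1 ≤ baseRadius m n z ^ α.1 := by
      obtain ⟨b, hb⟩ := Int.eq_ofNat_of_zero_le hα
      rw [hb, zpow_natCast, zpow_natCast]
      exact pow_le_pow_left₀ (by norm_num) hz.2 b
    rw [← ofReal_norm, norm_monom (n := n) hm h0, ENNReal.ofReal_rpow_of_nonneg
      (mul_nonneg (le_trans (by positivity) hb) (by positivity)) hq.le,
      ← ENNReal.ofReal_mul hc.le, Real.mul_rpow (le_trans (by positivity) hb) (by positivity)]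
    refine ENNReal.ofReal_le_ofReal (mul_le_mul ?_ (le_of_eq ?_) (by positivity) ?_)
    · exact Real.rpow_le_rpow (by positivity) hb hq.le
    · rw [mul_comm, Real.rpow_mul h0.le, Real.rpow_intCast]
    · exact Real.rpow_nonneg (le_trans (by positivity) hb) _
  refine lt_of_le_of_ne le_top fun h4 => h3.ne ?_
  rw [h4, ENNReal.mul_top (by simpa using hc)]

theorem differentiableOn_monom {m n : ℕ} {α : ℤ × ℤ} (hα : 0 ≤ α.1) :
    DifferentiableOn ℂ (monom α) (hartogsTriangle ((m : ℝ) / n)) := by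
  intro z hz
  have h2 : z.2 ≠ 0 :=
    norm_pos_iff.1 (lt_of_le_of_lt (Real.rpow_nonneg (norm_nonneg _) _) hz.1)
  unfold monom
  exact ((differentiableAt_fst.zpow (Or.inr hα)).mul
    (differentiableAt_snd.zpow (Or.inl h2))).differentiableWithinAt

/-- At a point with $z_1=0$ a negative power takes the default value $0$, but its norm blows up on
the punctured neighbourhood, so continuity fails. -/
theorem fst_nonneg_of_differentiableOn_monom {m n : ℕ} (hm : 0 < m) (hn : 0 < n) {α : ℤ × ℤ}
    (h : DifferentiableOn ℂ (monom α) (hartogsTriangle ((m : ℝ) / n))) : 0 ≤ α.1 := by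
  by_contra! hα
  have hmem : ((0 : ℂ), (1 / 2 : ℂ)) ∈ hartogsTriangle ((m : ℝ) / n) := by
    have : (m : ℝ) / n ≠ 0 := by positivity
    constructor <;> norm_num [Real.zero_rpow this]
  have hc : ContinuousAt (monom α) ((0 : ℂ), (1 / 2 : ℂ)) :=
    (h.differentiableAt (isOpen_hartogsTriangle.mem_nhds hmem)).continuousAt
  have hc' : ContinuousAt (fun t : ℂ => monom α (t, 1 / 2)) 0 :=
    ContinuousAt.comp (f := fun t : ℂ => (t, (1 / 2 : ℂ))) hc (by fun_prop)
  have h1 : Tendsto (fun t : ℂ => ‖monom α (t, 1 / 2)‖) (𝓝[≠] 0) atTop := by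
    simp only [monom, norm_mul]
    refine (tendsto_norm_cobounded_atTop.comp
      (tendsto_zpow_nhdsNE_zero_cobounded hα)).atTop_mul_const ?_
    rw [norm_pos_iff]
    exact zpow_ne_zero _ (by norm_num)
  exact not_tendsto_nhds_of_tendsto_atTop h1 _ (hc'.norm.tendsto.mono_left nhdsWithin_le_nhds)

/-- The hypothesis `hk` says that weight $k-1$ already fails to be $r$-integrable; weights are
integers, so an allowable one is at least $k$. -/
theorem allowable_bounds {m n : ℕ} (hm : 0 < m) (hn : 0 < n) {r : ℝ} (hr : 0 < r) {k : ℤ}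
    (hk : r * (k - 1) + 2 * n + 2 * m ≤ 0) {α : ℤ × ℤ}
    (hα : α ∈ allowable (hartogsTriangle ((m : ℝ) / n)) r) : 0 ≤ α.1 ∧ k ≤ weight m n α := by
  have h1 := fst_nonneg_of_differentiableOn_monom hm hn hα.1
  refine ⟨h1, ?_⟩
  have h2 := weight_of_memLp_monom hm hn hr h1 hα.2
  have h3 : r * ((k : ℝ) - 1) < r * weight m n α := by linarith
  have h4 : ((k - 1 : ℤ) : ℝ) < weight m n α := by
    push_cast; exact lt_of_mul_lt_mul_left h3 hr.le
  have h5 : k - 1 < weight m n α := by exact_mod_cast h4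
  omega

/-! ### Bounds for monomials, their norms and the kernel -/

/-- Extracting $|v|^k$ leaves nonnegative exponents on both radii, to which the bound by $\rho$
applies. -/
theorem norm_monom_le {m n : ℕ} (hm : 0 < m) {z : ℂ × ℂ} (h0 : 0 < fiberRadius m z) {ρ : ℝ}
    (h1 : fiberRadius m z ≤ ρ) (h2 : baseRadius m n z ≤ ρ) {α : ℤ × ℤ} {k : ℤ} (hα : 0 ≤ α.1)
    (hk : k ≤ weight m n α) :
    ‖monom α z‖ ≤ fiberRadius m z ^ k * (ρ ^ α.1.toNat * ρ ^ (weight m n α - k).toNat) := by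
  obtain ⟨a, ha⟩ := Int.eq_ofNat_of_zero_le hα
  obtain ⟨b, hb⟩ := Int.eq_ofNat_of_zero_le (sub_nonneg.2 hk)
  have hw : weight m n α = k + b := by omega
  rw [norm_monom (n := n) hm h0, ha, hb, hw, zpow_add₀ h0.ne', zpow_natCast, zpow_natCast,
    Int.toNat_natCast, Int.toNat_natCast]
  have hb0 := baseRadius_nonneg m n z
  calc _ = fiberRadius m z ^ k * (baseRadius m n z ^ a * fiberRadius m z ^ b) := by ring
    _ ≤ _ := by
      have : 0 ≤ ρ := h0.le.trans h1
      gcongr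

theorem norm_monom_le_zpow {m n : ℕ} (hm : 0 < m) (hn : 0 < n) {z : ℂ × ℂ}
    (hz : z ∈ hartogsTriangle ((m : ℝ) / n)) {α : ℤ × ℤ} {k : ℤ} (hα : 0 ≤ α.1)
    (hk : k ≤ weight m n α) : ‖monom α z‖ ≤ fiberRadius m z ^ k := by
  obtain ⟨h0, h1, h2⟩ := (mem_hartogsTriangle_iff hm hn).1 hz
  simpa using norm_monom_le (n := n) hm h0 h1.le h2.le hα hk

/-- Exponents can be lowered because the volume is finite. This makes `monomNormSq` a true norm for
allowable indices, not the default value $0$ of a divergent integral. -/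
theorem memLp_two_of_two_le {m n : ℕ} (hm : 0 < m) (hn : 0 < n) {r : ℝ} (hr : 2 ≤ r)
    {g : ℂ × ℂ → ℂ} (hg : MemLp g (ENNReal.ofReal r)
      (volume.restrict (hartogsTriangle ((m : ℝ) / n)))) :
    MemLp g 2 (volume.restrict (hartogsTriangle ((m : ℝ) / n))) := by
  have : IsFiniteMeasure (volume.restrict (hartogsTriangle ((m : ℝ) / n))) :=
    ⟨by simpa using volume_hartogsTriangle_lt_top hm hn⟩
  refine hg.mono_exponent ?_
  rw [← ENNReal.ofReal_ofNat]
  exact ENNReal.ofReal_le_ofReal hr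

theorem volume_outer_shell_pos {m n : ℕ} (hm : 0 < m) (hn : 0 < n) {ρ : ℝ} (h0 : 0 < ρ)
    (h1 : ρ < 1) : 0 < volume (hartogsTriangle ((m : ℝ) / n) ∩
      {z | ρ ≤ baseRadius m n z ∧ ρ ≤ fiberRadius m z}) := by
  have hc := continuous_fiberRadius m
  have hU : IsOpen (hartogsTriangle ((m : ℝ) / n) ∩
      {z : ℂ × ℂ | ρ * fiberRadius m z ^ n < ‖z.1‖ ∧ ρ < fiberRadius m z}) :=
    isOpen_hartogsTriangle.inter ((isOpen_lt (continuous_const.mul (hc.pow n))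
      continuous_fst.norm).inter (isOpen_lt continuous_const hc))
  refine lt_of_lt_of_le (hU.measure_pos volume ?_) (measure_mono ?_)
  -- The point $(1,1)$ has both radii equal to $1$; dilating it by $(1+\rho)/2$ places both strictly
  -- between $\rho$ and $1$.
  · have hs : 0 < (1 + ρ) / 2 := by linarith
    have hf : fiberRadius m (dilate m n ((1 + ρ) / 2) (1, 1)) = (1 + ρ) / 2 := by
      rw [fiberRadius_dilate hm n hs]; simp [fiberRadius]
    have hb : baseRadius m n (dilate m n ((1 + ρ) / 2) (1, 1)) = (1 + ρ) / 2 := by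
      rw [baseRadius_dilate hm n hs]; simp [baseRadius, fiberRadius]
    refine ⟨dilate m n ((1 + ρ) / 2) (1, 1), ?_, ?_, ?_⟩
    · rw [mem_hartogsTriangle_iff hm hn, hf, hb]
      exact ⟨by linarith, by linarith, by linarith⟩
    · rw [norm_fst_eq (n := n) (by rw [hf]; exact hs), hf, hb]
      have : 0 < ((1 + ρ) / 2) ^ n := by positivity
      exact mul_lt_mul_of_pos_right (by linarith) this
    · rw [hf]; linarith
  · rintro z ⟨hz, h2, h3⟩
    exact ⟨hz, (le_div_iff₀ (pow_pos ((mem_hartogsTriangle_iff hm hn).1 hz).1 n)).2 h2.le, h3.le⟩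

/-- Integrate only over the outer shell where both radii are at least $\rho$. There $|v|^k\ge1$
because $k\le0$, and the other exponents are nonnegative; the constant is the volume of the shell.
-/
theorem exists_le_monomNormSq {m n : ℕ} (hm : 0 < m) (hn : 0 < n) {ρ : ℝ} (h0 : 0 < ρ)
    (h1 : ρ < 1) {k : ℤ} (hk0 : k ≤ 0) :
    ∃ c > 0, ∀ α : ℤ × ℤ, 0 ≤ α.1 → k ≤ weight m n α →
      MemLp (monom α) 2 (volume.restrict (hartogsTriangle ((m : ℝ) / n))) →
      c * ((ρ ^ 2) ^ α.1.toNat * (ρ ^ 2) ^ (weight m n α - k).toNat) ≤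
        monomNormSq (hartogsTriangle ((m : ℝ) / n)) α := by
  set R := hartogsTriangle ((m : ℝ) / n) ∩ {z | ρ ≤ baseRadius m n z ∧ ρ ≤ fiberRadius m z}
  have hpos : 0 < volume R := volume_outer_shell_pos hm hn h0 h1
  have hfin : volume R < ∞ :=
    (measure_mono Set.inter_subset_left).trans_lt (volume_hartogsTriangle_lt_top hm hn)
  have hR : MeasurableSet R := isOpen_hartogsTriangle.measurableSet.inter
    ((measurableSet_le measurable_const (measurable_baseRadius m n)).inter
      (measurableSet_le measurable_const (continuous_fiberRadius m).measurable))
  refine ⟨volume.real R, ENNReal.toReal_pos hpos.ne' hfin.ne, fun α hα hk hL => ?_⟩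
  obtain ⟨a, ha⟩ := Int.eq_ofNat_of_zero_le hα
  obtain ⟨b, hb⟩ := Int.eq_ofNat_of_zero_le (sub_nonneg.2 hk)
  have hw : weight m n α = k + b := by omega
  have hint : IntegrableOn (fun w => ‖monom α w‖ ^ 2) (hartogsTriangle ((m : ℝ) / n)) :=
    hL.integrable_norm_pow two_ne_zero
  have e : volume.real R * ((ρ ^ 2) ^ α.1.toNat * (ρ ^ 2) ^ (weight m n α - k).toNat) =
      ∫ _ in R, ((ρ ^ 2) ^ a * (ρ ^ 2) ^ b) := by
    rw [setIntegral_const, ha, hb, Int.toNat_natCast, Int.toNat_natCast, smul_eq_mul]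
  rw [e, monomNormSq]
  calc _ ≤ ∫ w in R, ‖monom α w‖ ^ 2 := by
        refine setIntegral_mono_on (integrableOn_const hfin.ne)
          (hint.mono_set Set.inter_subset_left) hR fun z hz => ?_
        obtain ⟨hs0, hs1, -⟩ := (mem_hartogsTriangle_iff hm hn).1 hz.1
        have hsk : 1 ≤ fiberRadius m z ^ k := one_le_zpow_of_nonpos₀ hs0 hs1.le hk0
        have hz1 : ρ ^ a ≤ baseRadius m n z ^ a := pow_le_pow_left₀ h0.le hz.2.1 a
        have hz2 : ρ ^ b ≤ fiberRadius m z ^ b := pow_le_pow_left₀ h0.le hz.2.2 b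
        rw [norm_monom (n := n) hm hs0, ha, hw, zpow_add₀ hs0.ne', zpow_natCast, zpow_natCast,
          ← pow_mul, ← pow_mul, mul_comm 2, mul_comm 2, pow_mul, pow_mul, ← mul_pow]
        refine pow_le_pow_left₀ (by positivity) ?_ 2
        refine mul_le_mul hz1 ?_ (by positivity) (pow_nonneg (baseRadius_nonneg m n z) a)
        calc _ ≤ 1 * fiberRadius m z ^ b := by rw [one_mul]; exact hz2
          _ ≤ _ := by gcongr
    _ ≤ _ := setIntegral_mono_set hint (Eventually.of_forall fun _ => by positivity)
        (Set.inter_subset_left : R ⊆ _).eventuallyLE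

/-- As $m\ne0$, the pair $(\alpha_1,w-k)$ determines $\alpha$, so this is a subfamily of a product
of two geometric series. -/
theorem summable_pow_mul_pow_weight {m n : ℕ} (hm : 0 < m) {S : Set (ℤ × ℤ)} {k : ℤ}
    (hS : ∀ α ∈ S, 0 ≤ α.1 ∧ k ≤ weight m n α) {x : ℝ} (hx0 : 0 ≤ x) (hx1 : x < 1) :
    Summable fun α : S => x ^ α.1.1.toNat * x ^ (weight m n α.1 - k).toNat := by
  have h := (summable_geometric_of_lt_one hx0 hx1).mul_of_nonneg
    (summable_geometric_of_lt_one hx0 hx1) (fun _ => by positivity) (fun _ => by positivity)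
  refine h.comp_injective (i := fun α : S => (α.1.1.toNat, (weight m n α.1 - k).toNat)) ?_
  rintro ⟨α, hα⟩ ⟨β, hβ⟩ hαβ
  obtain ⟨h1, h2⟩ := hS α hα
  obtain ⟨h3, h4⟩ := hS β hβ
  simp only [Prod.mk.injEq] at hαβ
  have e1 : α.1 = β.1 := by omega
  have e2 : weight m n α = weight m n β := by omega
  have hm' : (m : ℤ) ≠ 0 := by exact_mod_cast hm.ne'
  have e3 : α.2 = β.2 := by
    unfold weight at e2
    rw [e1] at e2
    exact mul_left_cancel₀ hm' (by linarith)
  exact Subtype.ext (Prod.ext e1 e3)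

theorem exists_sum_norm_monom_div_le {m n : ℕ} (hm : 0 < m) (hn : 0 < n) {S : Set (ℤ × ℤ)} {k : ℤ}
    (hk0 : k ≤ 0) (hS : ∀ α ∈ S, 0 ≤ α.1 ∧ k ≤ weight m n α)
    (hL : ∀ α ∈ S, MemLp (monom α) 2 (volume.restrict (hartogsTriangle ((m : ℝ) / n))))
    {ρ : ℝ} (h0 : 0 < ρ) (h1 : ρ < 1) :
    ∃ a : S → ℝ, Summable a ∧ ∀ z ∈ hartogsTriangle ((m : ℝ) / n),
      fiberRadius m z ≤ ρ → baseRadius m n z ≤ ρ → ∀ α : S,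
        ‖monom α z‖ / monomNormSq (hartogsTriangle ((m : ℝ) / n)) α ≤
          a α * fiberRadius m z ^ k := by
  -- The lower bound for the norms is taken at radius $\rho_1$ with $\rho_1^2=(1+\rho)/2>\rho$, so
  -- the quotient is geometric with ratio $\rho/\rho_1^2<1$.
  set ρ₁ := √((1 + ρ) / 2) with hρ₁
  have hsq : ρ₁ ^ 2 = (1 + ρ) / 2 := Real.sq_sqrt (by linarith)
  have hpos : 0 < ρ₁ := Real.sqrt_pos.2 (by linarith)
  have hlt : ρ₁ < 1 := by
    rw [hρ₁, Real.sqrt_lt' one_pos]; linarith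
  obtain ⟨c, hc, hN⟩ := exists_le_monomNormSq hm hn hpos hlt hk0
  have hx1 : ρ / ρ₁ ^ 2 < 1 := by rw [hsq, div_lt_one (by linarith)]; linarith
  refine ⟨_, (summable_pow_mul_pow_weight hm hS (by positivity) hx1).mul_left c⁻¹,
    fun z hz hz1 hz2 α => ?_⟩
  obtain ⟨hα, hk⟩ := hS α α.2
  have hNα := hN α hα hk (hL α α.2)
  have hz0 := ((mem_hartogsTriangle_iff hm hn).1 hz).1
  have hM := norm_monom_le hm hz0 hz1 hz2 hα hk
  calc _ ≤ fiberRadius m z ^ k * (ρ ^ α.1.1.toNat * ρ ^ (weight m n α - k).toNat) /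
        (c * ((ρ₁ ^ 2) ^ α.1.1.toNat * (ρ₁ ^ 2) ^ (weight m n α - k).toNat)) :=
        div_le_div₀ (by positivity) hM (by positivity) hNα
    _ = _ := by
        rw [div_pow, div_pow]
        field_simp

theorem monomNormSq_nonneg (Ω : Set (ℂ × ℂ)) (α : ℤ × ℤ) : 0 ≤ monomNormSq Ω α :=
  integral_nonneg fun _ => by positivity

theorem norm_subBergmanTerm (Ω : Set (ℂ × ℂ)) (z w : ℂ × ℂ) (α : ℤ × ℤ) :
    ‖subBergmanTerm Ω z w α‖ = ‖monom α z‖ / monomNormSq Ω α * ‖monom α w‖ := by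
  rw [subBergmanTerm, norm_div, norm_mul, RCLike.norm_conj, Complex.norm_real,
    Real.norm_of_nonneg (monomNormSq_nonneg Ω α)]
  ring

theorem exists_norm_subBergmanTerm_le {m n : ℕ} (hm : 0 < m) (hn : 0 < n) {r : ℝ} (hr : 2 ≤ r)
    {k : ℤ} (hk0 : k ≤ 0) (hk : r * (k - 1) + 2 * n + 2 * m ≤ 0) {ρ : ℝ} (h0 : 0 < ρ)
    (h1 : ρ < 1) :
    ∃ a : allowable (hartogsTriangle ((m : ℝ) / n)) r → ℝ, Summable a ∧
      ∀ z ∈ hartogsTriangle ((m : ℝ) / n), fiberRadius m z ≤ ρ → baseRadius m n z ≤ ρ →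
      ∀ w ∈ hartogsTriangle ((m : ℝ) / n), ∀ α : allowable (hartogsTriangle ((m : ℝ) / n)) r,
        ‖subBergmanTerm (hartogsTriangle ((m : ℝ) / n)) z w α‖ ≤
          a α * (fiberRadius m z ^ k * fiberRadius m w ^ k) := by
  have hS : ∀ α ∈ allowable (hartogsTriangle ((m : ℝ) / n)) r, 0 ≤ α.1 ∧ k ≤ weight m n α :=
    fun α hα => allowable_bounds hm hn (by linarith) hk hα
  obtain ⟨a, ha, hb⟩ := exists_sum_norm_monom_div_le hm hn hk0 hS
    (fun α hα => memLp_two_of_two_le hm hn hr hα.2) h0 h1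
  refine ⟨a, ha, fun z hz hz1 hz2 w hw α => ?_⟩
  rw [norm_subBergmanTerm, ← mul_assoc]
  have hN := monomNormSq_nonneg (hartogsTriangle ((m : ℝ) / n)) α
  exact mul_le_mul (hb z hz hz1 hz2 α)
    (norm_monom_le_zpow hm hn hw (hS α α.2).1 (hS α α.2).2) (norm_nonneg _)
    ((div_nonneg (norm_nonneg _) hN).trans (hb z hz hz1 hz2 α))

theorem exists_radius {m n : ℕ} (hm : 0 < m) (hn : 0 < n) {z : ℂ × ℂ}
    (hz : z ∈ hartogsTriangle ((m : ℝ) / n)) :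
    ∃ ρ, 0 < ρ ∧ ρ < 1 ∧ fiberRadius m z < ρ ∧ baseRadius m n z < ρ := by
  obtain ⟨h0, h1, h2⟩ := (mem_hartogsTriangle_iff hm hn).1 hz
  obtain ⟨ρ, hρ, hρ1⟩ := exists_between (max_lt h1 h2)
  obtain ⟨h3, h4⟩ := max_lt_iff.1 hρ
  exact ⟨ρ, h0.trans h3, hρ1, h3, h4⟩

theorem summable_subBergmanTerm {m n : ℕ} (hm : 0 < m) (hn : 0 < n) {r : ℝ} (hr : 2 ≤ r)
    {k : ℤ} (hk0 : k ≤ 0) (hk : r * (k - 1) + 2 * n + 2 * m ≤ 0) {z w : ℂ × ℂ}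
    (hz : z ∈ hartogsTriangle ((m : ℝ) / n)) (hw : w ∈ hartogsTriangle ((m : ℝ) / n)) :
    Summable fun α : allowable (hartogsTriangle ((m : ℝ) / n)) r =>
      subBergmanTerm (hartogsTriangle ((m : ℝ) / n)) z w α := by
  obtain ⟨ρ, h0, h1, h2, h3⟩ := exists_radius hm hn hz
  obtain ⟨a, ha, hb⟩ := exists_norm_subBergmanTerm_le hm hn hr hk0 hk h0 h1
  exact (ha.mul_right _).of_norm_bounded (hb z hz h2.le h3.le w hw)

theorem measurable_subBergmanTerm (Ω : Set (ℂ × ℂ)) (z : ℂ × ℂ) (α : ℤ × ℤ) :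
    Measurable fun w => subBergmanTerm Ω z w α := by
  unfold subBergmanTerm
  exact ((Complex.continuous_conj.measurable.comp (measurable_monom α)).const_mul _).div_const _

theorem measurable_subBergmanKernel (Ω : Set (ℂ × ℂ)) (r : ℝ) (z : ℂ × ℂ) :
    Measurable fun w => subBergmanKernel Ω r z w := by
  unfold subBergmanKernel
  exact Measurable.tsum fun α => measurable_subBergmanTerm Ω z α

/-- The sub-Bergman kernel is bounded by `|v(z)| ^ k * |v(w)| ^ k`, uniformly for `z` in a
sublevel set of the radial coordinates. -/
theorem exists_norm_subBergmanKernel_le {m n : ℕ} (hm : 0 < m) (hn : 0 < n) {r : ℝ} (hr : 2 ≤ r)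
    {k : ℤ} (hk0 : k ≤ 0) (hk : r * (k - 1) + 2 * n + 2 * m ≤ 0) {ρ : ℝ} (h0 : 0 < ρ)
    (h1 : ρ < 1) :
    ∃ C : ℝ, ∀ z ∈ hartogsTriangle ((m : ℝ) / n), fiberRadius m z ≤ ρ → baseRadius m n z ≤ ρ →
      ∀ w ∈ hartogsTriangle ((m : ℝ) / n),
        ‖subBergmanKernel (hartogsTriangle ((m : ℝ) / n)) r z w‖ ≤
          C * fiberRadius m z ^ k * fiberRadius m w ^ k := by
  obtain ⟨a, ha, hb⟩ := exists_norm_subBergmanTerm_le hm hn hr hk0 hk h0 h1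
  refine ⟨∑' α, a α, fun z hz hz1 hz2 w hw => ?_⟩
  rw [mul_assoc]
  exact tsum_of_norm_bounded (ha.hasSum.mul_right _) (hb z hz hz1 hz2 w hw)

/-! ### The projection as an integral operator -/

section Operator

variable {m n : ℕ} {r : ℝ} {k : ℤ} {f : ℂ × ℂ → ℂ}

theorem integrableOn_subBergmanKernel_mul (hm : 0 < m) (hn : 0 < n) (hr : 2 ≤ r) (hk0 : k ≤ 0)
    (hk : r * (k - 1) + 2 * n + 2 * m ≤ 0)
    (hfm : AEStronglyMeasurable f (volume.restrict (hartogsTriangle ((m : ℝ) / n))))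
    (hf : IntegrableOn (fun w => fiberRadius m w ^ k • f w) (hartogsTriangle ((m : ℝ) / n)))
    {z : ℂ × ℂ} (hz : z ∈ hartogsTriangle ((m : ℝ) / n)) :
    IntegrableOn (fun w => subBergmanKernel (hartogsTriangle ((m : ℝ) / n)) r z w * f w)
      (hartogsTriangle ((m : ℝ) / n)) := by
  obtain ⟨ρ, h0, h1, h2, h3⟩ := exists_radius hm hn hz
  obtain ⟨C, hC⟩ := exists_norm_subBergmanKernel_le hm hn hr hk0 hk h0 h1
  refine Integrable.mono' (hf.norm.const_mul (C * fiberRadius m z ^ k))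
    ((measurable_subBergmanKernel _ r z).aestronglyMeasurable.mul hfm) ?_
  refine (ae_restrict_iff' isOpen_hartogsTriangle.measurableSet).2
    (Eventually.of_forall fun w hw => ?_)
  have hσ := fiberRadius_nonneg m w
  rw [norm_mul, norm_smul, Real.norm_of_nonneg (by positivity), ← mul_assoc]
  exact mul_le_mul_of_nonneg_right (hC z hz h2.le h3.le w hw) (norm_nonneg _)

/-- The constant does not depend on $f$. This gives both continuity of evaluation in $L^p$ and the
growth bound for fixed points. -/
theorem exists_norm_subBergman_le (hm : 0 < m) (hn : 0 < n) (hr : 2 ≤ r) (hk0 : k ≤ 0)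
    (hk : r * (k - 1) + 2 * n + 2 * m ≤ 0) {ρ : ℝ} (h0 : 0 < ρ) (h1 : ρ < 1) :
    ∃ C : ℝ, ∀ f : ℂ × ℂ → ℂ,
      IntegrableOn (fun w => fiberRadius m w ^ k • f w) (hartogsTriangle ((m : ℝ) / n)) →
      ∀ z ∈ hartogsTriangle ((m : ℝ) / n), fiberRadius m z ≤ ρ → baseRadius m n z ≤ ρ →
        ‖subBergman (hartogsTriangle ((m : ℝ) / n)) r f z‖ ≤ C * fiberRadius m z ^ k *
          ∫ w in hartogsTriangle ((m : ℝ) / n), ‖fiberRadius m w ^ k • f w‖ := by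
  obtain ⟨C, hC⟩ := exists_norm_subBergmanKernel_le hm hn hr hk0 hk h0 h1
  refine ⟨C, fun f hf z hz hz1 hz2 => ?_⟩
  rw [subBergman, ← integral_const_mul]
  refine norm_integral_le_of_norm_le (hf.norm.const_mul _) ?_
  refine (ae_restrict_iff' isOpen_hartogsTriangle.measurableSet).2
    (Eventually.of_forall fun w hw => ?_)
  have hσ := fiberRadius_nonneg m w
  rw [norm_mul, norm_smul, Real.norm_of_nonneg (by positivity), ← mul_assoc]
  exact mul_le_mul_of_nonneg_right (hC z hz hz1 hz2 w hw) (norm_nonneg _)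

/-- The integrals of the absolute values are summable, by the same majorant as for the kernel, so
sum and integral can be exchanged. -/
theorem hasSum_subBergman (hm : 0 < m) (hn : 0 < n) (hr : 2 ≤ r) (hk0 : k ≤ 0)
    (hk : r * (k - 1) + 2 * n + 2 * m ≤ 0)
    (hfm : AEStronglyMeasurable f (volume.restrict (hartogsTriangle ((m : ℝ) / n))))
    (hf : IntegrableOn (fun w => fiberRadius m w ^ k • f w) (hartogsTriangle ((m : ℝ) / n)))
    {z : ℂ × ℂ} (hz : z ∈ hartogsTriangle ((m : ℝ) / n)) :
    HasSum (fun α : allowable (hartogsTriangle ((m : ℝ) / n)) r =>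
      ∫ w in hartogsTriangle ((m : ℝ) / n),
        subBergmanTerm (hartogsTriangle ((m : ℝ) / n)) z w α * f w)
      (subBergman (hartogsTriangle ((m : ℝ) / n)) r f z) := by
  obtain ⟨ρ, h0, h1, h2, h3⟩ := exists_radius hm hn hz
  obtain ⟨a, ha, hb⟩ := exists_norm_subBergmanTerm_le hm hn hr hk0 hk h0 h1
  have hb' : ∀ α : allowable (hartogsTriangle ((m : ℝ) / n)) r,
      ∀ᵐ w ∂volume.restrict (hartogsTriangle ((m : ℝ) / n)),
      ‖subBergmanTerm (hartogsTriangle ((m : ℝ) / n)) z w α * f w‖ ≤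
        a α * fiberRadius m z ^ k * ‖fiberRadius m w ^ k • f w‖ := fun α => by
    refine (ae_restrict_iff' isOpen_hartogsTriangle.measurableSet).2
      (Eventually.of_forall fun w hw => ?_)
    have hσ := fiberRadius_nonneg m w
    rw [norm_mul, norm_smul, Real.norm_of_nonneg (by positivity), ← mul_assoc, mul_assoc (a α)]
    exact mul_le_mul_of_nonneg_right (hb z hz h2.le h3.le w hw α) (norm_nonneg _)
  have hint : ∀ α : allowable (hartogsTriangle ((m : ℝ) / n)) r,
      Integrable (fun w => subBergmanTerm (hartogsTriangle ((m : ℝ) / n)) z w α * f w)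
        (volume.restrict (hartogsTriangle ((m : ℝ) / n))) := fun α =>
    Integrable.mono' (hf.norm.const_mul _)
      ((measurable_subBergmanTerm _ z α).aestronglyMeasurable.mul hfm) (hb' α)
  have hsum : Summable fun α : allowable (hartogsTriangle ((m : ℝ) / n)) r =>
      ∫ w in hartogsTriangle ((m : ℝ) / n),
        ‖subBergmanTerm (hartogsTriangle ((m : ℝ) / n)) z w α * f w‖ := by
    refine Summable.of_nonneg_of_le (fun α => integral_nonneg fun _ => norm_nonneg _)
      (fun α => integral_mono_ae (hint α).norm (hf.norm.const_mul _) (hb' α)) ?_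
    simp only [integral_const_mul]
    exact (ha.mul_right _).mul_right _
  have := hasSum_integral_of_summable_integral_norm hint hsum
  simp only [tsum_mul_right] at this
  exact this

end Operator

/-! ### Laurent coefficients as Fourier coefficients on circles -/

/-- The `a`-th Fourier coefficient of `x ↦ h (exp (2πix) * z)`. -/
noncomputable def circleCoeff (h : ℂ → ℂ) (a : ℤ) (z : ℂ) : ℂ :=
  ∫ x : UnitAddCircle, fourier (-a) x * h (fourier 1 x * z) ∂AddCircle.haarAddCircle

theorem norm_fourier_apply (a : ℤ) (x : UnitAddCircle) : ‖(fourier a x : ℂ)‖ = 1 := by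
  rw [fourier_apply, Circle.norm_coe]

theorem fourier_apply_eq_zpow (a : ℤ) (x : UnitAddCircle) :
    (fourier a x : ℂ) = (fourier 1 x : ℂ) ^ a := by
  rw [fourier_apply, fourier_one, AddCircle.toCircle_zsmul, Circle.coe_zpow]

theorem fourier_apply_add (a : ℤ) (x y : UnitAddCircle) :
    (fourier a (x + y) : ℂ) = fourier a x * fourier a y := by
  simp only [fourier_apply, smul_add, AddCircle.toCircle_add, Circle.coe_mul]

theorem exists_eq_fourier_mul_norm (z : ℂ) : ∃ y : UnitAddCircle, z = fourier 1 y * (‖z‖ : ℂ) := by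
  refine ⟨((z.arg / (2 * Real.pi) : ℝ) : UnitAddCircle), ?_⟩
  rw [fourier_coe_apply]
  conv_lhs => rw [← Complex.norm_mul_exp_arg_mul_I z]
  rw [mul_comm]
  congr 2
  push_cast
  have : (Real.pi : ℂ) ≠ 0 := by exact_mod_cast Real.pi_ne_zero
  field_simp

theorem circleCoeff_fourier_mul (h : ℂ → ℂ) (a : ℤ) (y : UnitAddCircle) (z : ℂ) :
    circleCoeff h a (fourier 1 y * z) = fourier a y * circleCoeff h a z := by
  unfold circleCoeff
  rw [← integral_add_right_eq_self (μ := AddCircle.haarAddCircle)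
    (fun x : UnitAddCircle => fourier (-a) x * h (fourier 1 x * z)) y, ← integral_const_mul]
  refine integral_congr_ae (Eventually.of_forall fun x => ?_)
  have e : (fourier a y : ℂ) * fourier (-a) y = 1 := by
    rw [← fourier_add, add_neg_cancel, fourier_zero]
  simp only [fourier_apply_add]
  calc _ = (fourier a y * fourier (-a) y : ℂ) *
        (fourier (-a) x * h (fourier 1 x * fourier 1 y * z)) := by
        rw [e, one_mul, mul_assoc]
    _ = _ := by ring

/-- The substitution $\theta=2\pi x$ turns the Fourier integral into a contour integral of
$\zeta^{-a-1}h(\zeta)$, to which Cauchy's theorem applies. -/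
theorem circleCoeff_ofReal (h : ℂ → ℂ) (a : ℤ) {R : ℝ} (hR : 0 < R) :
    circleCoeff h a R = (R : ℂ) ^ a * ((2 * Real.pi * Complex.I)⁻¹ *
      ∮ ζ in C(0, R), (ζ - 0)⁻¹ • (ζ ^ (-a) * h ζ)) := by
  have h1 : circleCoeff h a R =
      fourierCoeff (fun x : UnitAddCircle => h (fourier 1 x * R)) a := rfl
  rw [h1, fourierCoeff_eq_intervalIntegral _ _ 0, circleIntegral]
  have hR' : (R : ℂ) ≠ 0 := by exact_mod_cast hR.ne'
  have h2 : ∀ x : ℝ, (fourier (-a) (x : UnitAddCircle) : ℂ) •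
      h (fourier 1 (x : UnitAddCircle) * R) =
      (fun θ : ℝ => (R : ℂ) ^ a * Complex.I⁻¹ * (deriv (circleMap 0 R) θ •
        ((circleMap 0 R θ - 0)⁻¹ • (circleMap 0 R θ ^ (-a) * h (circleMap 0 R θ)))))
        (2 * Real.pi * x) := by
    intro x
    have hc : circleMap 0 R (2 * Real.pi * x) = fourier 1 (x : UnitAddCircle) * R := by
      rw [circleMap_zero, fourier_coe_apply, mul_comm]
      congr 2
      push_cast
      ring
    have hx0 : (fourier 1 (x : UnitAddCircle) : ℂ) ≠ 0 :=
      norm_pos_iff.1 (by rw [norm_fourier_apply]; exact one_pos)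
    simp only [deriv_circleMap, hc, sub_zero, smul_eq_mul]
    rw [fourier_apply_eq_zpow (-a), mul_zpow, zpow_neg (R : ℂ)]
    have := Complex.I_ne_zero
    field_simp
  simp only [h2]
  rw [intervalIntegral.integral_comp_mul_left (fun θ : ℝ => (R : ℂ) ^ a * Complex.I⁻¹ *
      (deriv (circleMap 0 R) θ • ((circleMap 0 R θ - 0)⁻¹ •
        (circleMap 0 R θ ^ (-a) * h (circleMap 0 R θ))))) (by positivity : 2 * Real.pi ≠ 0),
    intervalIntegral.integral_const_mul]
  simp only [mul_zero, zero_add, mul_one, one_div, inv_one, one_smul, Complex.real_smul]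
  push_cast
  rw [mul_inv (2 * Real.pi : ℂ)]
  ring

theorem circleCoeff_ofReal_mul_zpow_of_le {h : ℂ → ℂ} {U : Set ℂ} (hU : IsOpen U)
    (hh : DifferentiableOn ℂ h U) (a : ℤ) {r R : ℝ} (hr : 0 < r) (hrR : r ≤ R)
    (hsub : ∀ ζ : ℂ, r ≤ ‖ζ‖ → ‖ζ‖ ≤ R → ζ ∈ U) :
    circleCoeff h a r * (R : ℂ) ^ a = circleCoeff h a R * (r : ℂ) ^ a := by
  have hd : ∀ ζ : ℂ, r ≤ ‖ζ‖ → ‖ζ‖ ≤ R → DifferentiableAt ℂ (fun ζ => ζ ^ (-a) * h ζ) ζ :=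
    fun ζ h1 h2 => (differentiableAt_id.zpow (Or.inl (norm_pos_iff.1 (hr.trans_le h1)))).mul
      (hh.differentiableAt (hU.mem_nhds (hsub ζ h1 h2)))
  rw [circleCoeff_ofReal h a hr, circleCoeff_ofReal h a (hr.trans_le hrR),
    Complex.circleIntegral_sub_center_inv_smul_eq_of_differentiable_on_annulus_off_countable
      (f := fun ζ => ζ ^ (-a) * h ζ) hr hrR Set.countable_empty]
  · ring
  · intro ζ hζ
    simp only [Set.mem_sdiff, Metric.mem_closedBall, dist_zero_right, Metric.mem_ball, not_lt] at hζ
    exact (hd ζ hζ.2 hζ.1).continuousAt.continuousWithinAt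
  · intro ζ hζ
    simp only [Set.mem_sdiff, Metric.mem_closedBall, dist_zero_right, Metric.mem_ball, not_le] at hζ
    exact hd ζ hζ.1.2.le hζ.1.1.le

/-- Fourier coefficients of a holomorphic function on concentric circles are those of a Laurent
monomial. -/
theorem circleCoeff_mul_zpow {h : ℂ → ℂ} {U : Set ℂ} (hU : IsOpen U)
    (hh : DifferentiableOn ℂ h U) (a : ℤ) {z w : ℂ} (hz : z ≠ 0) (hw : w ≠ 0)
    (hsub : ∀ ζ : ℂ, min ‖z‖ ‖w‖ ≤ ‖ζ‖ → ‖ζ‖ ≤ max ‖z‖ ‖w‖ → ζ ∈ U) :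
    circleCoeff h a z * w ^ a = circleCoeff h a w * z ^ a := by
  have key : circleCoeff h a (‖z‖ : ℂ) * (‖w‖ : ℂ) ^ a =
      circleCoeff h a (‖w‖ : ℂ) * (‖z‖ : ℂ) ^ a := by
    rcases le_total ‖z‖ ‖w‖ with hle | hle
    · rw [min_eq_left hle, max_eq_right hle] at hsub
      exact circleCoeff_ofReal_mul_zpow_of_le hU hh a (norm_pos_iff.2 hz) hle hsub
    · rw [min_eq_right hle, max_eq_left hle] at hsub
      exact (circleCoeff_ofReal_mul_zpow_of_le hU hh a (norm_pos_iff.2 hw) hle hsub).symm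
  obtain ⟨x, hx⟩ := exists_eq_fourier_mul_norm z
  obtain ⟨y, hy⟩ := exists_eq_fourier_mul_norm w
  rw [hx, hy, circleCoeff_fourier_mul, circleCoeff_fourier_mul, mul_zpow, mul_zpow,
    ← fourier_apply_eq_zpow, ← fourier_apply_eq_zpow]
  linear_combination (fourier a x : ℂ) * fourier a y * key

/-- For $a<0$ the integrand $\zeta^{-a-1}h(\zeta)$ has no pole, so its integral around the disc
vanishes. -/
theorem circleCoeff_eq_zero_of_neg {h : ℂ → ℂ} {U : Set ℂ} (hU : IsOpen U)
    (hh : DifferentiableOn ℂ h U) {a : ℤ} (ha : a < 0) {z : ℂ} (hz : z ≠ 0)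
    (hsub : ∀ ζ : ℂ, ‖ζ‖ ≤ ‖z‖ → ζ ∈ U) : circleCoeff h a z = 0 := by
  obtain ⟨x, hx⟩ := exists_eq_fourier_mul_norm z
  obtain ⟨b, hb⟩ := Int.eq_ofNat_of_zero_le (by omega : 0 ≤ -a - 1)
  have hz0 := norm_pos_iff.2 hz
  rw [hx, circleCoeff_fourier_mul, circleCoeff_ofReal h a hz0]
  have hI : (∮ ζ in C(0, ‖z‖), (ζ - 0)⁻¹ • (ζ ^ (-a) * h ζ)) = ∮ ζ in C(0, ‖z‖), ζ ^ b * h ζ := by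
    refine circleIntegral.integral_congr hz0.le fun ζ hζ => ?_
    have hζ0 : ζ ≠ 0 := norm_pos_iff.1 (by rw [mem_sphere_zero_iff_norm.1 hζ]; exact hz0)
    have e : -a = b + 1 := by omega
    simp only [sub_zero, smul_eq_mul, e]
    rw [zpow_add_one₀ hζ0, zpow_natCast]
    field_simp
  have hd : ∀ ζ : ℂ, ‖ζ‖ ≤ ‖z‖ → DifferentiableAt ℂ (fun ζ => ζ ^ b * h ζ) ζ := fun ζ hζ =>
    (differentiableAt_id.pow b).mul (hh.differentiableAt (hU.mem_nhds (hsub ζ hζ)))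
  rw [hI, Complex.circleIntegral_eq_zero_of_differentiable_on_off_countable hz0.le
    Set.countable_empty]
  · ring
  · exact fun ζ hζ => (hd ζ (by simpa using hζ)).continuousAt.continuousWithinAt
  · exact fun ζ hζ => hd ζ (by simpa using (Metric.ball_subset_closedBall hζ.1))

/-! ### Torus action and weight components -/

/-- The normalized Haar measure on the two-dimensional torus. -/
noncomputable def torusMeasure : Measure (UnitAddCircle × UnitAddCircle) :=
  (AddCircle.haarAddCircle (T := 1)).prod AddCircle.haarAddCircle

noncomputable instance : IsProbabilityMeasure torusMeasure := by
  unfold torusMeasure; infer_instance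

/-- The rotation action of the torus on `ℂ²`. -/
noncomputable def torusAct (x : UnitAddCircle × UnitAddCircle) (z : ℂ × ℂ) : ℂ × ℂ :=
  (fourier 1 x.1 * z.1, fourier 1 x.2 * z.2)

/-- The characters of the torus. -/
noncomputable def torusChar (α : ℤ × ℤ) (x : UnitAddCircle × UnitAddCircle) : ℂ :=
  fourier α.1 x.1 * fourier α.2 x.2

/-- The component of `f` of weight `α` under the rotation action of the torus. -/
noncomputable def weightComponent (f : ℂ × ℂ → ℂ) (α : ℤ × ℤ) (z : ℂ × ℂ) : ℂ :=
  ∫ x, torusChar (-α) x * f (torusAct x z) ∂torusMeasure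

theorem continuous_torusAct :
    Continuous fun q : (UnitAddCircle × UnitAddCircle) × (ℂ × ℂ) => torusAct q.1 q.2 := by
  unfold torusAct
  fun_prop

theorem continuous_torusChar (α : ℤ × ℤ) : Continuous (torusChar α) := by
  unfold torusChar
  fun_prop

theorem norm_torusChar (α : ℤ × ℤ) (x : UnitAddCircle × UnitAddCircle) : ‖torusChar α x‖ = 1 := by
  rw [torusChar, norm_mul, norm_fourier_apply, norm_fourier_apply, one_mul]

theorem monom_torusAct (α : ℤ × ℤ) (x : UnitAddCircle × UnitAddCircle) (z : ℂ × ℂ) :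
    monom α (torusAct x z) = torusChar α x * monom α z := by
  simp only [monom, torusAct, torusChar, mul_zpow, ← fourier_apply_eq_zpow]
  ring

theorem torusAct_mem_hartogsTriangle {γ : ℝ} (x : UnitAddCircle × UnitAddCircle) {z : ℂ × ℂ} :
    torusAct x z ∈ hartogsTriangle γ ↔ z ∈ hartogsTriangle γ := by
  simp only [hartogsTriangle, torusAct, Set.mem_ofPred_eq, norm_mul, norm_fourier_apply, one_mul]

theorem continuous_comp_torusAct {γ : ℝ} {f : ℂ × ℂ → ℂ} (hf : ContinuousOn f (hartogsTriangle γ))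
    {z : ℂ × ℂ} (hz : z ∈ hartogsTriangle γ) : Continuous fun x => f (torusAct x z) :=
  hf.comp_continuous (continuous_torusAct.comp (continuous_id.prodMk continuous_const))
    fun x => (torusAct_mem_hartogsTriangle x).2 hz

theorem integrable_torus {E : Type*} [NormedAddCommGroup E] {F : UnitAddCircle × UnitAddCircle → E}
    (hF : Continuous F) : Integrable F torusMeasure :=
  hF.integrable_of_hasCompactSupport (HasCompactSupport.of_compactSpace F)

theorem weightComponent_eq_integral_fst {γ : ℝ} {f : ℂ × ℂ → ℂ}
    (hf : ContinuousOn f (hartogsTriangle γ)) (α : ℤ × ℤ) {z : ℂ × ℂ}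
    (hz : z ∈ hartogsTriangle γ) :
    weightComponent f α z = ∫ y : UnitAddCircle, fourier (-α.2) y *
      circleCoeff (fun ζ => f (ζ, fourier 1 y * z.2)) α.1 z.1 ∂AddCircle.haarAddCircle := by
  rw [weightComponent, torusMeasure, integral_prod_symm _ (integrable_torus
    ((continuous_torusChar (-α)).fun_mul (continuous_comp_torusAct hf hz)))]
  simp only [circleCoeff, ← integral_const_mul, torusChar, torusAct]
  refine integral_congr_ae (Eventually.of_forall fun y => integral_congr_ae
    (Eventually.of_forall fun x => ?_))
  simp only [Prod.fst_neg, Prod.snd_neg]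
  ring

theorem weightComponent_eq_integral_snd {γ : ℝ} {f : ℂ × ℂ → ℂ}
    (hf : ContinuousOn f (hartogsTriangle γ)) (α : ℤ × ℤ) {z : ℂ × ℂ}
    (hz : z ∈ hartogsTriangle γ) :
    weightComponent f α z = ∫ x : UnitAddCircle, fourier (-α.1) x *
      circleCoeff (fun ζ => f (fourier 1 x * z.1, ζ)) α.2 z.2 ∂AddCircle.haarAddCircle := by
  rw [weightComponent, torusMeasure, integral_prod _ (integrable_torus
    ((continuous_torusChar (-α)).fun_mul (continuous_comp_torusAct hf hz)))]
  simp only [circleCoeff, ← integral_const_mul, torusChar, torusAct]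
  refine integral_congr_ae (Eventually.of_forall fun y => integral_congr_ae
    (Eventually.of_forall fun x => ?_))
  simp only [Prod.fst_neg, Prod.snd_neg]
  ring

section Hartogs

variable {γ : ℝ} {f : ℂ × ℂ → ℂ}

theorem hartogsTriangle_snd_ne_zero {z : ℂ × ℂ} (hz : z ∈ hartogsTriangle γ) : z.2 ≠ 0 :=
  norm_pos_iff.1 (lt_of_le_of_lt (Real.rpow_nonneg (norm_nonneg _) _) hz.1)

theorem hartogsTriangle_mono (hγ : 0 ≤ γ) {z w : ℂ × ℂ} (hz : z ∈ hartogsTriangle γ)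
    (h1 : ‖w.1‖ ≤ ‖z.1‖) (h2 : ‖w.2‖ = ‖z.2‖) : w ∈ hartogsTriangle γ :=
  ⟨by rw [h2]; exact (Real.rpow_le_rpow (norm_nonneg _) h1 hγ).trans_lt hz.1,
    by rw [h2]; exact hz.2⟩

theorem differentiableOn_fst_section (hf : DifferentiableOn ℂ f (hartogsTriangle γ)) (b : ℂ) :
    DifferentiableOn ℂ (fun ζ => f (ζ, b)) {ζ | (ζ, b) ∈ hartogsTriangle γ} :=
  hf.comp (f := fun ζ : ℂ => (ζ, b)) (by fun_prop) fun _ h => h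

theorem differentiableOn_snd_section (hf : DifferentiableOn ℂ f (hartogsTriangle γ)) (a : ℂ) :
    DifferentiableOn ℂ (fun ζ => f (a, ζ)) {ζ | (a, ζ) ∈ hartogsTriangle γ} :=
  hf.comp (f := fun ζ : ℂ => (a, ζ)) (by fun_prop) fun _ h => h

theorem weightComponent_mul_zpow_fst (hγ : 0 ≤ γ) (hf : DifferentiableOn ℂ f (hartogsTriangle γ))
    (α : ℤ × ℤ) {a a' b : ℂ} (ha : a ≠ 0) (ha' : a' ≠ 0) (h : (a, b) ∈ hartogsTriangle γ)
    (h' : (a', b) ∈ hartogsTriangle γ) :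
    weightComponent f α (a, b) * a' ^ α.1 = weightComponent f α (a', b) * a ^ α.1 := by
  rw [weightComponent_eq_integral_fst hf.continuousOn α h,
    weightComponent_eq_integral_fst hf.continuousOn α h', ← integral_mul_const,
    ← integral_mul_const]
  refine integral_congr_ae (Eventually.of_forall fun y => ?_)
  simp only [mul_assoc]
  congr 1
  refine circleCoeff_mul_zpow ((isOpen_hartogsTriangle_of_nonneg hγ).preimage (by fun_prop :
    Continuous fun ζ : ℂ => (ζ, (fourier 1 y : ℂ) * b))) (differentiableOn_fst_section hf _) α.1 ha ha'
    fun ζ _ hζ => ?_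
  have e : ‖(fourier 1 y : ℂ) * b‖ = ‖b‖ := by rw [norm_mul, norm_fourier_apply, one_mul]
  rcases max_cases ‖a‖ ‖a'‖ with hm | hm
  · exact hartogsTriangle_mono hγ h (hζ.trans hm.1.le) e
  · exact hartogsTriangle_mono hγ h' (hζ.trans hm.1.le) e

theorem weightComponent_mul_zpow_snd (hγ : 0 ≤ γ) (hf : DifferentiableOn ℂ f (hartogsTriangle γ))
    (α : ℤ × ℤ) {a b b' : ℂ} (h : (a, b) ∈ hartogsTriangle γ) (h' : (a, b') ∈ hartogsTriangle γ) :
    weightComponent f α (a, b) * b' ^ α.2 = weightComponent f α (a, b') * b ^ α.2 := by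
  rw [weightComponent_eq_integral_snd hf.continuousOn α h,
    weightComponent_eq_integral_snd hf.continuousOn α h', ← integral_mul_const,
    ← integral_mul_const]
  refine integral_congr_ae (Eventually.of_forall fun x => ?_)
  simp only [mul_assoc]
  congr 1
  refine circleCoeff_mul_zpow ((isOpen_hartogsTriangle_of_nonneg hγ).preimage (by fun_prop :
    Continuous fun ζ : ℂ => ((fourier 1 x : ℂ) * a, ζ))) (differentiableOn_snd_section hf _) α.2
    (hartogsTriangle_snd_ne_zero h) (hartogsTriangle_snd_ne_zero h') fun ζ hζ1 hζ2 => ?_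
  have e : ‖(fourier 1 x : ℂ) * a‖ = ‖a‖ := by rw [norm_mul, norm_fourier_apply, one_mul]
  constructor
  · simp only [e]
    exact (lt_min h.1 h'.1).trans_le hζ1
  · exact hζ2.trans_lt (max_lt h.2 h'.2)

/-- Each component is a constant multiple of $e_\alpha$ off $z_1=0$; the cross-multiplied form needs
no division. -/
theorem weightComponent_mul_monom (hγ : 0 ≤ γ) (hf : DifferentiableOn ℂ f (hartogsTriangle γ))
    (α : ℤ × ℤ) {z w : ℂ × ℂ} (hz : z ∈ hartogsTriangle γ) (hw : w ∈ hartogsTriangle γ)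
    (hz1 : z.1 ≠ 0) (hw1 : w.1 ≠ 0) :
    weightComponent f α z * monom α w = weightComponent f α w * monom α z := by
  obtain ⟨a, b⟩ := z
  obtain ⟨a', b'⟩ := w
  -- Lower $|z_1|$ to a value $s\ne0$ admissible over both $b$ and $b'$, then change $z_2$, then
  -- restore $z_1$. Every move stays in one slice of the domain.
  obtain ⟨s, hs, hsa, hsa'⟩ : ∃ s : ℂ, s ≠ 0 ∧ ‖s‖ ≤ ‖a‖ ∧ ‖s‖ ≤ ‖a'‖ := by
    rcases le_total ‖a‖ ‖a'‖ with h | h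
    · exact ⟨a, hz1, le_rfl, h⟩
    · exact ⟨a', hw1, h, le_rfl⟩
  have h1 : (s, b) ∈ hartogsTriangle γ := hartogsTriangle_mono hγ hz hsa rfl
  have h2 : (s, b') ∈ hartogsTriangle γ := hartogsTriangle_mono hγ hw hsa' rfl
  have e1 := weightComponent_mul_zpow_fst hγ hf α hz1 hs hz h1
  have e2 := weightComponent_mul_zpow_snd hγ hf α h1 h2
  have e3 := weightComponent_mul_zpow_fst hγ hf α hs hw1 h2 hw
  have hs' : s ^ α.1 ≠ 0 := zpow_ne_zero _ hs
  refine mul_right_cancel₀ hs' ?_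
  simp only [monom]
  linear_combination (a' ^ α.1 * b' ^ α.2) * e1 + (a ^ α.1 * a' ^ α.1) * e2 +
    (a ^ α.1 * b ^ α.2) * e3

/-- Slices with $z_2$ fixed are full discs about $0$, so no negative power of $z_1$ occurs. -/
theorem weightComponent_eq_zero_of_neg (hγ : 0 ≤ γ) (hf : DifferentiableOn ℂ f (hartogsTriangle γ))
    {α : ℤ × ℤ} (hα : α.1 < 0) {z : ℂ × ℂ} (hz : z ∈ hartogsTriangle γ) (hz1 : z.1 ≠ 0) :
    weightComponent f α z = 0 := by
  rw [weightComponent_eq_integral_fst hf.continuousOn α hz]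
  refine (integral_congr_ae (Eventually.of_forall fun y => ?_)).trans (integral_zero _ _)
  have e : ‖(fourier 1 y : ℂ) * z.2‖ = ‖z.2‖ := by rw [norm_mul, norm_fourier_apply, one_mul]
  rw [circleCoeff_eq_zero_of_neg ((isOpen_hartogsTriangle_of_nonneg hγ).preimage (by fun_prop :
    Continuous fun ζ : ℂ => (ζ, (fourier 1 y : ℂ) * z.2))) (differentiableOn_fst_section hf _) hα hz1
    fun ζ hζ => hartogsTriangle_mono hγ hz hζ e, mul_zero]

end Hartogs

/-! ### Fourier inversion and averaging over the torus -/

/-- Pointwise Fourier inversion on the two-dimensional torus. -/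
theorem hasSum_torus_fourier {F : UnitAddCircle × UnitAddCircle → ℂ} (hF : Continuous F)
    (hs : Summable fun α : ℤ × ℤ => ∫ x, torusChar (-α) x * F x ∂torusMeasure) :
    HasSum (fun α : ℤ × ℤ => ∫ x, torusChar (-α) x * F x ∂torusMeasure) (F 0) := by
  let G : C(UnitAddTorus (Fin 2), ℂ) := ⟨fun x => F (x 0, x 1), by fun_prop⟩
  have e : ∀ ν : Fin 2 → ℤ, UnitAddTorus.mFourierCoeff G ν =
      ∫ x, torusChar (-(ν 0, ν 1)) x * F x ∂torusMeasure := by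
    intro ν
    rw [torusMeasure, ← (measurePreserving_finTwoArrow
      (AddCircle.haarAddCircle (T := 1))).integral_comp
        MeasurableEquiv.finTwoArrow.measurableEmbedding]
    unfold UnitAddTorus.mFourierCoeff
    refine integral_congr_ae (Eventually.of_forall fun x => ?_)
    simp [UnitAddTorus.mFourier, torusChar, G, MeasurableEquiv.finTwoArrow]
  have hs' : Summable (UnitAddTorus.mFourierCoeff G) := by
    rw [show UnitAddTorus.mFourierCoeff G =
      (fun α : ℤ × ℤ => ∫ x, torusChar (-α) x * F x ∂torusMeasure) ∘ finTwoArrowEquiv ℤ from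
        funext e]
    exact (Equiv.summable_iff _).2 hs
  have := UnitAddTorus.hasSum_mFourier_series_apply_of_summable hs' 0
  rw [← (finTwoArrowEquiv ℤ).hasSum_iff]
  refine (this.congr_fun fun ν => ?_ : HasSum _ (G 0))
  rw [e ν]
  simp [UnitAddTorus.mFourier]

theorem measurePreserving_fourier_mul (x : UnitAddCircle) :
    MeasurePreserving (fun z : ℂ => (fourier 1 x : ℂ) * z) := by
  have := (rotation (AddCircle.toCircle x)).measurePreserving
  convert this using 2 with z
  simp [rotation_apply]

theorem measurePreserving_torusAct (x : UnitAddCircle × UnitAddCircle) :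
    MeasurePreserving (torusAct x) :=
  (measurePreserving_fourier_mul x.1).prod (measurePreserving_fourier_mul x.2)

theorem measurePreserving_torusAct_prod :
    MeasurePreserving (fun q : (UnitAddCircle × UnitAddCircle) × (ℂ × ℂ) => torusAct q.1 q.2)
      (torusMeasure.prod volume) volume := by
  have h : MeasurePreserving
      (fun q : (UnitAddCircle × UnitAddCircle) × (ℂ × ℂ) => (q.1, torusAct q.1 q.2))
      (torusMeasure.prod volume) (torusMeasure.prod volume) :=
    (MeasurePreserving.id torusMeasure).skew_product continuous_torusAct.measurable
      (Eventually.of_forall fun x => (measurePreserving_torusAct x).map_eq)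
  exact measurePreserving_snd.comp h

section Average

variable {γ : ℝ} {f : ℂ × ℂ → ℂ}

theorem ae_fst_ne_zero : ∀ᵐ z : ℂ × ℂ, z.1 ≠ 0 := by
  have h : ∀ᵐ w : ℂ, w ≠ 0 := by simp [ae_iff]
  exact Measure.quasiMeasurePreserving_fst.ae h

theorem measurable_indicator_hartogsTriangle (hγ : 0 ≤ γ) (hf : ContinuousOn f (hartogsTriangle γ)) :
    Measurable ((hartogsTriangle γ).indicator f) := by
  classical
  rw [← Set.piecewise_eq_indicator]
  exact hf.measurable_piecewise continuousOn_const
    (isOpen_hartogsTriangle_of_nonneg hγ).measurableSet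

/-- Characters have modulus $1$, and on a probability space the $L^1$ norm is at most the $L^r$
norm. -/
theorem enorm_weightComponent_rpow_le {r : ℝ} (hr : 1 ≤ r) (hf : ContinuousOn f (hartogsTriangle γ))
    (α : ℤ × ℤ) {z : ℂ × ℂ} (hz : z ∈ hartogsTriangle γ) :
    ‖weightComponent f α z‖ₑ ^ r ≤ ∫⁻ x, ‖f (torusAct x z)‖ₑ ^ r ∂torusMeasure := by
  have hc := continuous_comp_torusAct hf hz
  have hr0 : 0 < r := by linarith
  have h1 : ‖weightComponent f α z‖ₑ ≤ eLpNorm (fun x => f (torusAct x z)) 1 torusMeasure := by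
    rw [eLpNorm_one_eq_lintegral_enorm]
    refine (enorm_integral_le_lintegral_enorm _).trans (lintegral_mono fun x => ?_)
    simp only [enorm_mul]
    rw [← ofReal_norm (torusChar (-α) x), norm_torusChar, ENNReal.ofReal_one, one_mul]
  have h2 : eLpNorm (fun x => f (torusAct x z)) 1 torusMeasure ≤
      eLpNorm (fun x => f (torusAct x z)) (ENNReal.ofReal r) torusMeasure :=
    eLpNorm_le_eLpNorm_of_exponent_le (by simpa using hr) hc.aestronglyMeasurable
  refine (ENNReal.rpow_le_rpow (h1.trans h2) hr0.le).trans (le_of_eq ?_)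
  rw [eLpNorm_eq_lintegral_rpow_enorm_toReal (by simpa using hr0) ENNReal.ofReal_ne_top,
    ENNReal.toReal_ofReal hr0.le, ← ENNReal.rpow_mul, one_div, inv_mul_cancel₀ hr0.ne',
    ENNReal.rpow_one]

/-- Integrate the pointwise estimate and exchange the integrals; rotations preserve both the domain
and the measure. Thus a Laurent term of an $L^r$ function is itself in $L^r$. -/
theorem lintegral_weightComponent_le (hγ : 0 ≤ γ) {r : ℝ} (hr : 1 ≤ r)
    (hf : ContinuousOn f (hartogsTriangle γ)) (α : ℤ × ℤ) :
    ∫⁻ z in hartogsTriangle γ, ‖weightComponent f α z‖ₑ ^ r ≤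
      ∫⁻ z in hartogsTriangle γ, ‖f z‖ₑ ^ r := by
  have hH := (isOpen_hartogsTriangle_of_nonneg hγ).measurableSet
  have hG := measurable_indicator_hartogsTriangle hγ hf
  have hG' : Measurable fun z => ‖(hartogsTriangle γ).indicator f z‖ₑ ^ r := hG.enorm.pow_const r
  calc _ ≤ ∫⁻ z in hartogsTriangle γ, ∫⁻ x, ‖(hartogsTriangle γ).indicator f (torusAct x z)‖ₑ ^ r
        ∂torusMeasure := by
        refine setLIntegral_mono' hH fun z hz => ?_
        refine (enorm_weightComponent_rpow_le hr hf α hz).trans (le_of_eq ?_)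
        refine lintegral_congr fun x => ?_
        rw [Set.indicator_of_mem ((torusAct_mem_hartogsTriangle x).2 hz)]
    _ ≤ ∫⁻ z, ∫⁻ x, ‖(hartogsTriangle γ).indicator f (torusAct x z)‖ₑ ^ r ∂torusMeasure :=
        setLIntegral_le_lintegral _ _
    _ = ∫⁻ q, ‖(hartogsTriangle γ).indicator f (torusAct q.1 q.2)‖ₑ ^ r
          ∂(torusMeasure.prod volume) :=
        (lintegral_prod_symm' _ (hG'.comp continuous_torusAct.measurable)).symm
    _ = ∫⁻ z, ‖(hartogsTriangle γ).indicator f z‖ₑ ^ r :=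
        measurePreserving_torusAct_prod.lintegral_comp hG'
    _ = _ := by
        rw [← lintegral_indicator hH]
        refine lintegral_congr fun z => ?_
        by_cases hz : z ∈ hartogsTriangle γ
        · simp [hz]
        · simp [hz, (by linarith : 0 < r)]

/-- Averaging the integrand over rotations replaces $f$ by its component of weight $\alpha$, which
turns the integral into $c\,\|e_\alpha\|_2^2$. -/
theorem integral_conj_monom_mul (hγ : 0 ≤ γ)
    {α : ℤ × ℤ} {c : ℂ} (hc : ∀ z ∈ hartogsTriangle γ, z.1 ≠ 0 →
      weightComponent f α z = c * monom α z)
    (hint : IntegrableOn (fun w => conj (monom α w) * f w) (hartogsTriangle γ)) :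
    ∫ w in hartogsTriangle γ, conj (monom α w) * f w = c * monomNormSq (hartogsTriangle γ) α := by
  have hH := (isOpen_hartogsTriangle_of_nonneg hγ).measurableSet
  set Φ := (hartogsTriangle γ).indicator fun w => conj (monom α w) * f w with hΦ
  have hΦi : Integrable Φ := (integrable_indicator_iff hH).2 hint
  have hΦc : Integrable (fun q : (UnitAddCircle × UnitAddCircle) × (ℂ × ℂ) => Φ (torusAct q.1 q.2))
      (torusMeasure.prod volume) :=
    measurePreserving_torusAct_prod.integrable_comp_of_integrable hΦi
  have h1 : ∫ q, Φ (torusAct q.1 q.2) ∂(torusMeasure.prod volume) = ∫ w, Φ w := by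
    have h := integral_map (μ := torusMeasure.prod volume)
      measurePreserving_torusAct_prod.measurable.aemeasurable (f := Φ)
      (by rw [measurePreserving_torusAct_prod.map_eq]; exact hΦi.aestronglyMeasurable)
    rw [← h, measurePreserving_torusAct_prod.map_eq]
  rw [← integral_indicator hH, ← hΦ, ← h1, integral_prod_symm _ hΦc]
  have h2 : (fun w => ∫ x, Φ (torusAct x w) ∂torusMeasure) =ᵐ[volume]
      (hartogsTriangle γ).indicator fun w => c * ((‖monom α w‖ ^ 2 : ℝ) : ℂ) := by
    filter_upwards [ae_fst_ne_zero] with w hw1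
    by_cases hw : w ∈ hartogsTriangle γ
    · rw [Set.indicator_of_mem hw]
      have e : ∀ x, Φ (torusAct x w) =
          conj (monom α w) * (torusChar (-α) x * f (torusAct x w)) := fun x => by
        have hx : conj (torusChar α x) = torusChar (-α) x := by
          simp only [torusChar, map_mul, Prod.fst_neg, Prod.snd_neg, fourier_neg]
        rw [hΦ, Set.indicator_of_mem ((torusAct_mem_hartogsTriangle x).2 hw), monom_torusAct,
          map_mul, hx]
        ring
      simp only [e]
      rw [integral_const_mul]
      change conj (monom α w) * weightComponent f α w = _
      rw [hc w hw hw1, mul_left_comm, ← Complex.normSq_eq_conj_mul_self, Complex.normSq_eq_norm_sq]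
    · rw [Set.indicator_of_notMem hw]
      refine (integral_congr_ae (Eventually.of_forall fun x => ?_)).trans (integral_zero _ _)
      exact Set.indicator_of_notMem (fun h => hw ((torusAct_mem_hartogsTriangle x).1 h)) _
  rw [integral_congr_ae h2, integral_indicator hH, integral_const_mul, integral_complex_ofReal,
    monomNormSq]

end Average

/-! ### The reproducing property -/

/-- The sub-Bergman projection reproduces `A^r` off the hyperplane `z₁ = 0`. -/
theorem subBergman_eq_self {m n : ℕ} (hm : 0 < m) (hn : 0 < n) {r : ℝ} (hr : 2 ≤ r) {k : ℤ}
    (hk0 : k ≤ 0) (hk : r * (k - 1) + 2 * n + 2 * m ≤ 0) {g : ℂ × ℂ → ℂ}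
    (hg : g ∈ bergmanSpace (hartogsTriangle ((m : ℝ) / n)) r)
    (hgk : IntegrableOn (fun w => fiberRadius m w ^ k • g w) (hartogsTriangle ((m : ℝ) / n)))
    {z : ℂ × ℂ} (hz : z ∈ hartogsTriangle ((m : ℝ) / n)) (hz1 : z.1 ≠ 0) :
    subBergman (hartogsTriangle ((m : ℝ) / n)) r g z = g z := by
  have hγ : (0 : ℝ) ≤ (m : ℝ) / n := by positivity
  have hH := (isOpen_hartogsTriangle (m := m) (n := n)).measurableSet
  set H := hartogsTriangle ((m : ℝ) / n) with hHdef
  have hmonom : ∀ α : ℤ × ℤ, monom α z ≠ 0 := fun α =>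
    mul_ne_zero (zpow_ne_zero _ hz1) (zpow_ne_zero _ (hartogsTriangle_snd_ne_zero hz))
  set c : ℤ × ℤ → ℂ := fun α => weightComponent g α z / monom α z with hcdef
  have hc : ∀ α, ∀ w ∈ H, w.1 ≠ 0 → weightComponent g α w = c α * monom α w := by
    intro α w hw hw1
    have := weightComponent_mul_monom hγ hg.1 α hz hw hz1 hw1
    rw [hcdef, div_mul_eq_mul_div, this, mul_div_cancel_right₀ _ (hmonom α)]
  -- A nonzero coefficient makes $e_\alpha$ allowable: the component is in $L^r$, and a negative
  -- $\alpha_1$ would give a zero component.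
  have hcS : ∀ α, α ∉ allowable H r → c α = 0 := by
    intro α hα
    by_contra hcα
    refine hα ⟨?_, (measurable_monom α).aestronglyMeasurable, ?_⟩
    · refine differentiableOn_monom (not_lt.1 fun hneg => hcα ?_)
      rw [hcdef]
      simp only [weightComponent_eq_zero_of_neg hγ hg.1 hneg hz hz1, zero_div]
    · have hr0 : 0 < r := by linarith
      have hlt := hg.2.2
      rw [eLpNorm_lt_top_iff_lintegral_rpow_enorm_lt_top (by simpa using hr0) ENNReal.ofReal_ne_top,
        ENNReal.toReal_ofReal hr0.le] at hlt ⊢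
      have h1 := (lintegral_weightComponent_le hγ (by linarith : 1 ≤ r) hg.1.continuousOn α).trans_lt
        hlt
      have h2 : ∫⁻ w in H, ‖weightComponent g α w‖ₑ ^ r =
          ‖c α‖ₑ ^ r * ∫⁻ w in H, ‖monom α w‖ₑ ^ r := by
        rw [← lintegral_const_mul' _ _ (by simp [hr0.le])]
        refine lintegral_congr_ae ?_
        filter_upwards [ae_restrict_mem hH, ae_restrict_of_ae ae_fst_ne_zero] with w hw hw1
        rw [hc α w hw hw1, enorm_mul, ENNReal.mul_rpow_of_nonneg _ _ hr0.le]
      rw [h2] at h1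
      refine lt_of_le_of_ne le_top fun h4 => h1.ne ?_
      rw [h4, ENNReal.mul_top]
      simp [hcα]
  have hterm : ∀ α : allowable H r,
      ∫ w in H, subBergmanTerm H z w α * g w = weightComponent g α z := by
    intro α
    have hb := allowable_bounds hm hn (by linarith) hk α.2
    have hα2 := memLp_two_of_two_le hm hn hr α.2.2
    have hg2 := memLp_two_of_two_le hm hn hr hg.2
    have hint : IntegrableOn (fun w => conj (monom α w) * g w) H :=
      hα2.star.integrable_mul hg2
    have hN : (0 : ℝ) < monomNormSq H α := by
      obtain ⟨C, hC, hle⟩ := exists_le_monomNormSq hm hn (ρ := 1 / 2) (by norm_num) (by norm_num) hk0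
      exact lt_of_lt_of_le (by positivity) (hle α hb.1 hb.2 hα2)
    have hN' : (monomNormSq H α : ℂ) ≠ 0 := by exact_mod_cast hN.ne'
    have e : ∀ w, subBergmanTerm H z w α * g w =
        monom α z / (monomNormSq H α : ℂ) * (conj (monom α w) * g w) := fun w => by
      rw [subBergmanTerm]; ring
    simp only [e]
    rw [integral_const_mul, integral_conj_monom_mul hγ (hc α) hint, hc α z hz hz1,
      ← hHdef]
    field_simp
  have hsum := hasSum_subBergman hm hn hr hk0 hk hg.2.1 hgk hz
  simp only [← hHdef, hterm] at hsum
  -- The missing components vanish, so the sum over allowable indices is a sum over all of $\mathbb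
  -- Z^2$. Its convergence is the summability that Fourier inversion requires.
  have hsum' : HasSum (fun α => weightComponent g α z) (subBergman H r g z) := by
    refine (hasSum_subtype_iff_of_support_subset (f := fun α => weightComponent g α z)
      (s := allowable H r) ?_).1 hsum
    intro α hα
    by_contra hαS
    exact hα (by simp only [hc α z hz hz1, hcS α hαS, zero_mul])
  have hF := hasSum_torus_fourier (continuous_comp_torusAct hg.1.continuousOn hz) hsum'.summable
  rw [show torusAct 0 z = z by simp [torusAct]] at hF
  exact hsum'.unique hF

/-! ### Convergence in the mean and dilations -/

/-- Almost everywhere convergence, together with an asymptotic bound of the norms by the norm of the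
limit, implies convergence in the mean of order `p`. -/
theorem tendsto_lintegral_enorm_sub_rpow {X E : Type*} [MeasurableSpace X] [NormedAddCommGroup E]
    {μ : Measure X} {f : X → E} {g : ℕ → X → E} {p : ℝ} (hp : 1 ≤ p)
    (hf : AEStronglyMeasurable f μ) (hg : ∀ j, AEStronglyMeasurable (g j) μ)
    (hfin : ∫⁻ x, ‖f x‖ₑ ^ p ∂μ ≠ ∞)
    (hlim : ∀ᵐ x ∂μ, Tendsto (fun j => g j x) atTop (𝓝 (f x))) {J : ℕ → ℝ≥0∞}
    (hJ : Tendsto J atTop (𝓝 1)) (hle : ∀ j, ∫⁻ x, ‖g j x‖ₑ ^ p ∂μ ≤ J j * ∫⁻ x, ‖f x‖ₑ ^ p ∂μ) :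
    Tendsto (fun j => ∫⁻ x, ‖g j x - f x‖ₑ ^ p ∂μ) atTop (𝓝 0) := by
  have hp0 : 0 < p := by linarith
  set u : X → ℝ≥0∞ := fun x => ‖f x‖ₑ ^ p with hu
  set v : ℕ → X → ℝ≥0∞ := fun j x => ‖g j x‖ₑ ^ p with hv
  set d : ℕ → X → ℝ≥0∞ := fun j x => ‖g j x - f x‖ₑ ^ p with hd
  have hum : AEMeasurable u μ := hf.enorm.pow_const p
  have hvm : ∀ j, AEMeasurable (v j) μ := fun j => (hg j).enorm.pow_const p
  have hdm : ∀ j, AEMeasurable (d j) μ := fun j => ((hg j).sub hf).enorm.pow_const p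
  set C : ℝ≥0∞ := 2 ^ (p - 1) with hC
  have hCt : C ≠ ∞ := ENNReal.rpow_ne_top_of_nonneg (by linarith) (by simp)
  have hufin : ∀ᵐ x ∂μ, u x ≠ ∞ := (ae_lt_top' hum hfin).mono fun x h => h.ne
  have hvlim : ∀ᵐ x ∂μ, Tendsto (fun j => v j x) atTop (𝓝 (u x)) := by
    filter_upwards [hlim] with x hx
    exact (ENNReal.continuous_rpow_const.tendsto _).comp hx.enorm
  have hdlim : ∀ᵐ x ∂μ, Tendsto (fun j => d j x) atTop (𝓝 0) := by
    filter_upwards [hlim] with x hx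
    have h1 : Tendsto (fun j => ‖g j x - f x‖ₑ) atTop (𝓝 0) := by
      simpa using (hx.sub_const (f x)).enorm
    have := (ENNReal.continuous_rpow_const (y := p)).tendsto 0 |>.comp h1
    rw [ENNReal.zero_rpow_of_pos hp0] at this
    exact this
  -- the deficit `u - v j` is dominated by `u`
  have hδ : Tendsto (fun j => ∫⁻ x, (u x - v j x) ∂μ) atTop (𝓝 0) := by
    have := tendsto_lintegral_of_dominated_convergence' (F := fun j x => u x - v j x)
      (f := fun _ => 0) u (fun j => hum.sub (hvm j))
      (fun j => Eventually.of_forall fun x => tsub_le_self) hfin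
      (by
        filter_upwards [hvlim, hufin] with x hx hxf
        simpa using ENNReal.Tendsto.sub tendsto_const_nhds hx (Or.inl hxf))
    simpa using this
  -- The excess is controlled through $\int(v_j-u)^+=\int v_j-\int u+\int(u-v_j)^+$, written without
  -- subtracting infinities; this is where the bound on the norms enters.
  have hε : Tendsto (fun j => ∫⁻ x, (v j x - u x) ∂μ) atTop (𝓝 0) := by
    have hid : ∀ j, ∫⁻ x, (v j x - u x) ∂μ ≤
        J j * ∫⁻ x, u x ∂μ + ∫⁻ x, (u x - v j x) ∂μ - ∫⁻ x, u x ∂μ := by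
      intro j
      refine ENNReal.le_sub_of_add_le_left hfin ?_
      calc _ = ∫⁻ x, (u x + (v j x - u x)) ∂μ := (lintegral_add_left' hum _).symm
        _ = ∫⁻ x, (v j x + (u x - v j x)) ∂μ := by
          refine lintegral_congr fun x => ?_
          rw [add_tsub_eq_max, add_tsub_eq_max, max_comm]
        _ = ∫⁻ x, v j x ∂μ + ∫⁻ x, (u x - v j x) ∂μ := lintegral_add_left' (hvm j) _
        _ ≤ _ := by gcongr; exact hle j
    have hup : Tendsto (fun j => J j * ∫⁻ x, u x ∂μ + ∫⁻ x, (u x - v j x) ∂μ - ∫⁻ x, u x ∂μ) atTop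
        (𝓝 0) := by
      have h1 := ENNReal.Tendsto.mul_const (b := ∫⁻ x, u x ∂μ) hJ (Or.inr hfin)
      have h2 := ENNReal.Tendsto.sub (h1.add hδ) (tendsto_const_nhds (x := ∫⁻ x, u x ∂μ))
        (Or.inr hfin)
      simpa using h2
    exact tendsto_of_tendsto_of_tendsto_of_le_of_le tendsto_const_nhds hup (fun _ => zero_le) hid
  -- Truncating at $2Cu$ supplies an integrable majorant for dominated convergence.
  have hmin : Tendsto (fun j => ∫⁻ x, min (d j x) (C * (2 * u x)) ∂μ) atTop (𝓝 0) := by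
    have := tendsto_lintegral_of_dominated_convergence'
      (F := fun j x => min (d j x) (C * (2 * u x))) (f := fun _ => 0) (fun x => C * (2 * u x))
      (fun j => (hdm j).min ((hum.const_mul 2).const_mul C))
      (fun j => Eventually.of_forall fun x => min_le_right _ _)
      (by
        rw [lintegral_const_mul' _ _ hCt, lintegral_const_mul' _ _ (by simp)]
        exact ENNReal.mul_ne_top hCt (ENNReal.mul_ne_top (by simp) hfin))
      (by
        filter_upwards [hdlim] with x hx
        exact tendsto_of_tendsto_of_tendsto_of_le_of_le tendsto_const_nhds hx (fun _ => zero_le)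
          fun j => min_le_left _ _)
    simpa using this
  -- By convexity $d_j\le C(v_j+u)\le 2Cu+C(v_j-u)^+$ with $C=2^{p-1}$, so whatever the truncation
  -- removes is paid for by the excess.
  have hbound : ∀ j, ∫⁻ x, d j x ∂μ ≤
      ∫⁻ x, min (d j x) (C * (2 * u x)) ∂μ + C * ∫⁻ x, (v j x - u x) ∂μ := by
    intro j
    rw [← lintegral_const_mul' _ _ hCt,
      ← lintegral_add_left' ((hdm j).min ((hum.const_mul 2).const_mul C))]
    refine lintegral_mono fun x => ?_
    have h1 : d j x ≤ C * (v j x + u x) :=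
      (ENNReal.rpow_le_rpow (enorm_sub_le) hp0.le).trans
        (ENNReal.rpow_add_le_mul_rpow_add_rpow _ _ hp)
    have h2 : C * (v j x + u x) ≤ C * (2 * u x) + C * (v j x - u x) := by
      have h3 : v j x + u x ≤ 2 * u x + (v j x - u x) :=
        calc v j x + u x ≤ (u x + (v j x - u x)) + u x := add_le_add_left le_add_tsub _
          _ = _ := by ring
      rw [← mul_add]
      gcongr
    rcases le_total (d j x) (C * (2 * u x)) with h | h
    · rw [min_eq_left h]; exact le_self_add
    · rw [min_eq_right h]; exact h1.trans h2
  refine tendsto_of_tendsto_of_tendsto_of_le_of_le tendsto_const_nhds ?_ (fun _ => zero_le) hbound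
  simpa using hmin.add (ENNReal.Tendsto.const_mul hε (Or.inr hCt))

/-- The inverse of the Jacobian of `dilate m n ρ`. -/
noncomputable def dilateFactor (m n : ℕ) (ρ : ℝ) : ℝ≥0∞ :=
  ENNReal.ofReal |((ρ ^ (n + 1)) ^ 2)⁻¹| * ENNReal.ofReal |((ρ ^ m) ^ 2)⁻¹|

theorem map_dilate (m n : ℕ) {ρ : ℝ} (hρ : 0 < ρ) :
    Measure.map (dilate m n ρ) volume = dilateFactor m n ρ • (volume : Measure (ℂ × ℂ)) := by
  have h1 := Measure.map_addHaar_smul (volume : Measure ℂ) (pow_pos hρ (n + 1)).ne'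
  have h2 := Measure.map_addHaar_smul (volume : Measure ℂ) (pow_pos hρ m).ne'
  rw [Complex.finrank_real_complex] at h1 h2
  have h3 := Measure.map_prod_map (volume : Measure ℂ) (volume : Measure ℂ)
    (measurable_const_smul (ρ ^ (n + 1))) (measurable_const_smul (ρ ^ m))
  rw [Measure.volume_eq_prod]
  change Measure.map (Prod.map _ _) _ = _
  rw [← h3, h1, h2, Measure.prod_smul_left, Measure.prod_smul_right, smul_smul, dilateFactor]

theorem tendsto_dilateFactor (m n : ℕ) {ρ : ℕ → ℝ} (hρ : Tendsto ρ atTop (𝓝 1)) :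
    Tendsto (fun j => dilateFactor m n (ρ j)) atTop (𝓝 1) := by
  have h : ∀ N : ℕ, Tendsto (fun j => ENNReal.ofReal |((ρ j ^ N) ^ 2)⁻¹|) atTop (𝓝 1) := fun N => by
    have : Tendsto (fun j => |((ρ j ^ N) ^ 2)⁻¹|) atTop (𝓝 |(((1 : ℝ) ^ N) ^ 2)⁻¹|) :=
      (((hρ.pow N).pow 2).inv₀ (by simp)).abs
    simpa using ENNReal.tendsto_ofReal this
  have := ENNReal.Tendsto.mul (h (n + 1)) (Or.inl one_ne_zero) (h m) (Or.inl one_ne_zero)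
  rw [one_mul] at this
  exact this

theorem continuous_dilate (m n : ℕ) : Continuous fun q : ℝ × (ℂ × ℂ) => dilate m n q.1 q.2 := by
  unfold dilate
  fun_prop

/-- Dilation maps the domain into itself, so a change of variables costs only the inverse Jacobian,
which tends to $1$ as $\rho\to1$. -/
theorem lintegral_dilate_le {m n : ℕ} (hm : 0 < m) (hn : 0 < n) {ρ : ℝ} (h0 : 0 < ρ) (h1 : ρ < 1)
    {f : ℂ × ℂ → ℂ} (hf : ContinuousOn f (hartogsTriangle ((m : ℝ) / n))) {p : ℝ} (hp : 0 < p) :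
    ∫⁻ z in hartogsTriangle ((m : ℝ) / n), ‖f (dilate m n ρ z)‖ₑ ^ p ≤
      dilateFactor m n ρ * ∫⁻ z in hartogsTriangle ((m : ℝ) / n), ‖f z‖ₑ ^ p := by
  have hH := (isOpen_hartogsTriangle (m := m) (n := n)).measurableSet
  have hG := measurable_indicator_hartogsTriangle (by positivity) hf
  set H := hartogsTriangle ((m : ℝ) / n) with hHdef
  have hG' : Measurable fun z => ‖H.indicator f z‖ₑ ^ p := hG.enorm.pow_const p
  have hd : Measurable (dilate m n ρ) :=
    ((continuous_dilate m n).comp (Continuous.prodMk_right ρ)).measurable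
  calc _ ≤ ∫⁻ z in H, ‖H.indicator f (dilate m n ρ z)‖ₑ ^ p :=
        setLIntegral_mono' hH fun z hz => by
          rw [Set.indicator_of_mem (dilate_mem hm hn h0 h1 hz)]
    _ ≤ ∫⁻ z, ‖H.indicator f (dilate m n ρ z)‖ₑ ^ p := setLIntegral_le_lintegral _ _
    _ = ∫⁻ z, ‖H.indicator f z‖ₑ ^ p ∂(Measure.map (dilate m n ρ) volume) :=
        (lintegral_map hG' hd).symm
    _ = dilateFactor m n ρ * ∫⁻ z, ‖H.indicator f z‖ₑ ^ p := by
        rw [map_dilate m n h0, lintegral_smul_measure, smul_eq_mul]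
    _ = _ := by
        rw [← lintegral_indicator hH]
        congr 1
        refine lintegral_congr fun z => ?_
        by_cases hz : z ∈ H
        · simp [hz]
        · simp [hz, hp]

theorem zpow_le_zpow_left_of_nonpos {k : ℤ} (hk : k ≤ 0) {a b : ℝ} (ha : 0 < a) (hab : a ≤ b) :
    b ^ k ≤ a ^ k := by
  have := inv_anti₀ (zpow_pos ha (-k)) (zpow_le_zpow_left₀ (neg_nonneg.2 hk) ha.le hab)
  simpa only [zpow_neg, inv_inv] using this

/-! ### Continuity of the projected function -/

/-- The projection is a locally uniformly convergent series of multiples of allowable monomials.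
Continuity is what later upgrades almost everywhere identities to all points. -/
theorem continuousOn_subBergman {m n : ℕ} (hm : 0 < m) (hn : 0 < n) {r : ℝ} (hr : 2 ≤ r) {k : ℤ}
    (hk0 : k ≤ 0) (hk : r * (k - 1) + 2 * n + 2 * m ≤ 0) {f : ℂ × ℂ → ℂ}
    (hfm : AEStronglyMeasurable f (volume.restrict (hartogsTriangle ((m : ℝ) / n))))
    (hf : IntegrableOn (fun w => fiberRadius m w ^ k • f w) (hartogsTriangle ((m : ℝ) / n))) :
    ContinuousOn (subBergman (hartogsTriangle ((m : ℝ) / n)) r f)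
      (hartogsTriangle ((m : ℝ) / n)) := by
  have hO := isOpen_hartogsTriangle (m := m) (n := n)
  intro z₀ hz₀
  obtain ⟨ρ, h0, h1, h2, h3⟩ := exists_radius hm hn hz₀
  obtain ⟨a, ha, hb⟩ := exists_norm_subBergmanTerm_le hm hn hr hk0 hk h0 h1
  have hσ₀ := ((mem_hartogsTriangle_iff hm hn).1 hz₀).1
  have hc := continuous_fiberRadius m
  -- On this neighbourhood $|v|$ is bounded below, which bounds $|v|^k$ for $k\le0$. The condition
  -- $|u|<\rho$ is multiplied out so that openness follows from continuity of both sides.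
  set V : Set (ℂ × ℂ) := hartogsTriangle ((m : ℝ) / n) ∩ {z | fiberRadius m z < ρ ∧
    ‖z.1‖ < ρ * fiberRadius m z ^ n ∧ fiberRadius m z₀ / 2 < fiberRadius m z} with hV
  have hVo : IsOpen V := hO.inter ((isOpen_lt hc continuous_const).inter
    ((isOpen_lt continuous_fst.norm (continuous_const.mul (hc.pow n))).inter
      (isOpen_lt continuous_const hc)))
  have hzV : z₀ ∈ V := ⟨hz₀, h2, (div_lt_iff₀ (pow_pos hσ₀ n)).1 h3, half_lt_self hσ₀⟩
  have hkey : ContinuousOn (fun z => ∑' α : allowable (hartogsTriangle ((m : ℝ) / n)) r,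
      ∫ w in hartogsTriangle ((m : ℝ) / n),
        subBergmanTerm (hartogsTriangle ((m : ℝ) / n)) z w α * f w) V := by
    refine continuousOn_tsum (u := fun α => a α * ((fiberRadius m z₀ / 2) ^ k *
      ∫ w in hartogsTriangle ((m : ℝ) / n), ‖fiberRadius m w ^ k • f w‖)) (fun α => ?_)
      (ha.mul_right _) ?_
    · have e : ∀ z w, subBergmanTerm (hartogsTriangle ((m : ℝ) / n)) z w α * f w =
          monom α z * (conj (monom α w) /
            (monomNormSq (hartogsTriangle ((m : ℝ) / n)) α : ℂ) * f w) := fun z w => by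
        rw [subBergmanTerm]; ring
      simp only [e, integral_const_mul]
      exact ((α.2.1.continuousOn).mono Set.inter_subset_left).mul continuousOn_const
    · rintro α z ⟨hz, hz1, hz2, hz3⟩
      have hσ := ((mem_hartogsTriangle_iff hm hn).1 hz).1
      have hz2' : baseRadius m n z ≤ ρ := ((div_lt_iff₀ (pow_pos hσ n)).2 hz2).le
      rw [← mul_assoc, ← integral_const_mul]
      refine norm_integral_le_of_norm_le (hf.norm.const_mul _) ?_
      refine (ae_restrict_iff' hO.measurableSet).2 (Eventually.of_forall fun w hw => ?_)
      have hσw := fiberRadius_nonneg m w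
      have hzk : fiberRadius m z ^ k ≤ (fiberRadius m z₀ / 2) ^ k :=
        zpow_le_zpow_left_of_nonpos hk0 (by positivity) hz3.le
      have ht := hb z hz hz1.le hz2' w hw α
      have hw0 : 0 < fiberRadius m w ^ k :=
        zpow_pos ((mem_hartogsTriangle_iff hm hn).1 hw).1 k
      have hz0 : 0 < fiberRadius m z ^ k := zpow_pos hσ k
      have ha0 : 0 ≤ a α := nonneg_of_mul_nonneg_left ((norm_nonneg _).trans ht) (by positivity)
      rw [norm_mul, norm_smul, Real.norm_of_nonneg hw0.le, ← mul_assoc]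
      refine mul_le_mul_of_nonneg_right (ht.trans ?_) (norm_nonneg _)
      rw [← mul_assoc]
      gcongr
  refine ContinuousAt.continuousWithinAt ?_
  refine ((hkey.congr fun z hz => ?_).continuousAt (hVo.mem_nhds hzV))
  exact (hasSum_subBergman hm hn hr hk0 hk hfm hf hz.1).tsum_eq.symm

/-! ### The closure of $A^r$ as the set of fixed points -/

section Main

variable {m n : ℕ} {p p' r : ℝ} {k : ℤ} {f : ℂ × ℂ → ℂ}

theorem memLp_of_le_exponent (hm : 0 < m) (hn : 0 < n) (hpr : p ≤ r)
    (hf : MemLp f (ENNReal.ofReal r) (volume.restrict (hartogsTriangle ((m : ℝ) / n)))) :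
    MemLp f (ENNReal.ofReal p) (volume.restrict (hartogsTriangle ((m : ℝ) / n))) := by
  have : IsFiniteMeasure (volume.restrict (hartogsTriangle ((m : ℝ) / n))) :=
    ⟨by simpa using volume_hartogsTriangle_lt_top hm hn⟩
  exact hf.mono_exponent (ENNReal.ofReal_le_ofReal hpr)

/-- Hölder's inequality with $|v|^k\in L^{p'}$; `hkp` is exactly that integrability. -/
theorem integrableOn_fiberRadius_zpow_smul (hm : 0 < m) (hn : 0 < n) (hpp : p.HolderConjugate p')
    (hkp : 0 < p' * k + 2 * n + 2 * m)
    (hf : MemLp f (ENNReal.ofReal p) (volume.restrict (hartogsTriangle ((m : ℝ) / n)))) :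
    IntegrableOn (fun w => fiberRadius m w ^ k • f w) (hartogsTriangle ((m : ℝ) / n)) := by
  have := hpp.symm.ennrealOfReal
  exact memLp_one_iff_integrable.1 (hf.smul (memLp_fiberRadius_zpow hm hn hpp.symm.pos hkp))

/-- `L^p` convergence implies pointwise convergence of the sub-Bergman projections. -/
theorem tendsto_subBergman (hm : 0 < m) (hn : 0 < n) (hpp : p.HolderConjugate p') (hr : 2 ≤ r)
    (hk0 : k ≤ 0) (hk : r * (k - 1) + 2 * n + 2 * m ≤ 0) (hkp : 0 < p' * k + 2 * n + 2 * m)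
    (hf : MemLp f (ENNReal.ofReal p) (volume.restrict (hartogsTriangle ((m : ℝ) / n))))
    {g : ℕ → ℂ × ℂ → ℂ}
    (hg : ∀ j, MemLp (g j) (ENNReal.ofReal p) (volume.restrict (hartogsTriangle ((m : ℝ) / n))))
    (hlim : Tendsto (fun j => eLpNorm (g j - f) (ENNReal.ofReal p)
      (volume.restrict (hartogsTriangle ((m : ℝ) / n)))) atTop (𝓝 0))
    {z : ℂ × ℂ} (hz : z ∈ hartogsTriangle ((m : ℝ) / n)) :
    Tendsto (fun j => subBergman (hartogsTriangle ((m : ℝ) / n)) r (g j) z) atTop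
      (𝓝 (subBergman (hartogsTriangle ((m : ℝ) / n)) r f z)) := by
  obtain ⟨ρ, h0, h1, h2, h3⟩ := exists_radius hm hn hz
  obtain ⟨C, hC⟩ := exists_norm_subBergman_le hm hn hr hk0 hk h0 h1
  have hw := fun {h : ℂ × ℂ → ℂ} => integrableOn_fiberRadius_zpow_smul (f := h) hm hn hpp hkp
  have hσ := memLp_fiberRadius_zpow hm hn hpp.symm.pos hkp
  have hdiff : ∀ j, subBergman (hartogsTriangle ((m : ℝ) / n)) r (g j - f) z =
      subBergman (hartogsTriangle ((m : ℝ) / n)) r (g j) z -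
        subBergman (hartogsTriangle ((m : ℝ) / n)) r f z := fun j => by
    simp only [subBergman, Pi.sub_apply, mul_sub]
    exact integral_sub
      (integrableOn_subBergmanKernel_mul hm hn hr hk0 hk (hg j).1 (hw (hg j)) hz)
      (integrableOn_subBergmanKernel_mul hm hn hr hk0 hk hf.1 (hw hf) hz)
  have hint : Tendsto (fun j => ∫ w in hartogsTriangle ((m : ℝ) / n),
      ‖fiberRadius m w ^ k • (g j - f) w‖) atTop (𝓝 0) := by
    have hconj := hpp.symm.ennrealOfReal
    have hup := ENNReal.Tendsto.const_mul hlim (Or.inr hσ.2.ne)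
    rw [mul_zero] at hup
    have hen : Tendsto (fun j => ∫⁻ w in hartogsTriangle ((m : ℝ) / n),
        ‖fiberRadius m w ^ k • (g j - f) w‖ₑ) atTop (𝓝 0) := by
      refine tendsto_of_tendsto_of_tendsto_of_le_of_le tendsto_const_nhds hup (fun _ => zero_le)
        fun j => ?_
      have := eLpNorm_smul_le_mul_eLpNorm (p := ENNReal.ofReal p') (q := ENNReal.ofReal p) (r := 1)
        ((hg j).sub hf).1 hσ.1
      rwa [eLpNorm_one_eq_lintegral_enorm] at this
    have := (ENNReal.tendsto_toReal ENNReal.zero_ne_top).comp hen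
    refine this.congr fun j => ?_
    exact (integral_norm_eq_lintegral_enorm (hw ((hg j).sub hf)).1).symm
  rw [tendsto_iff_norm_sub_tendsto_zero]
  have hup := hint.const_mul (C * fiberRadius m z ^ k)
  rw [mul_zero] at hup
  refine squeeze_zero (fun _ => norm_nonneg _) (fun j => ?_) hup
  rw [← hdiff]
  exact hC _ (hw ((hg j).sub hf)) z hz h2.le h3.le

theorem subBergman_eq_of_approx (hm : 0 < m) (hn : 0 < n) (hpp : p.HolderConjugate p')
    (hpr : p < r) (hr : 2 ≤ r) (hk0 : k ≤ 0) (hk : r * (k - 1) + 2 * n + 2 * m ≤ 0)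
    (hkp : 0 < p' * k + 2 * n + 2 * m)
    (hf : f ∈ bergmanSpace (hartogsTriangle ((m : ℝ) / n)) p)
    (h : ApproxByBergman (hartogsTriangle ((m : ℝ) / n)) p r f) :
    ∀ z ∈ hartogsTriangle ((m : ℝ) / n),
      subBergman (hartogsTriangle ((m : ℝ) / n)) r f z = f z := by
  obtain ⟨g, hg, hlim⟩ := h
  have hO := isOpen_hartogsTriangle (m := m) (n := n)
  have hgp := fun j => memLp_of_le_exponent hm hn hpr.le (hg j).2
  have hw := fun {h : ℂ × ℂ → ℂ} => integrableOn_fiberRadius_zpow_smul (f := h) hm hn hpp hkp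
  -- Along a subsequence $g_j\to f$ almost everywhere, while the projections of $g_j$ converge at
  -- every point of the domain; the two sequences agree off $z_1=0$.
  obtain ⟨ns, hns, hae⟩ := (tendstoInMeasure_of_tendsto_eLpNorm (by simpa using hpp.pos)
    (fun j => (hgp j).1) hf.2.1 hlim).exists_seq_tendsto_ae
  -- Both sides are continuous on an open set, so equality almost everywhere suffices; this also
  -- recovers the points with $z_1=0$.
  refine Measure.eqOn_open_of_ae_eq (μ := volume) ?_ hO
    (continuousOn_subBergman hm hn hr hk0 hk hf.2.1 (hw hf.2)) hf.1.continuousOn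
  filter_upwards [hae, ae_restrict_mem hO.measurableSet, ae_restrict_of_ae ae_fst_ne_zero]
    with z hz hzH hz1
  have h1 := (tendsto_subBergman hm hn hpp hr hk0 hk hkp hf.2 hgp hlim hzH).comp hns.tendsto_atTop
  refine tendsto_nhds_unique (h1.congr fun i => ?_) hz
  exact subBergman_eq_self hm hn hr hk0 hk (hg _) (hw (hgp _)) hzH hz1

/-- The approximants are dilates of $f$. They evaluate $f$ only where both radii are at most
$\rho_j<1$, and there $f$, being its own projection, is bounded by a multiple of $|v|^k\in L^r$. -/
theorem approx_of_subBergman_eq (hm : 0 < m) (hn : 0 < n) (hpp : p.HolderConjugate p')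
    (hr : 2 ≤ r) (hk0 : k ≤ 0) (hk : r * (k - 1) + 2 * n + 2 * m ≤ 0)
    (hkr : 0 < r * k + 2 * n + 2 * m) (hkp : 0 < p' * k + 2 * n + 2 * m)
    (hf : f ∈ bergmanSpace (hartogsTriangle ((m : ℝ) / n)) p)
    (h : ∀ z ∈ hartogsTriangle ((m : ℝ) / n),
      subBergman (hartogsTriangle ((m : ℝ) / n)) r f z = f z) :
    ApproxByBergman (hartogsTriangle ((m : ℝ) / n)) p r f := by
  have hO := isOpen_hartogsTriangle (m := m) (n := n)
  have hw := integrableOn_fiberRadius_zpow_smul hm hn hpp hkp hf.2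
  set ρ : ℕ → ℝ := fun j => 1 - 1 / ((j : ℝ) + 2) with hρdef
  have hρ0 : ∀ j, 0 < ρ j := fun j => by
    have : 1 / ((j : ℝ) + 2) < 1 := by
      rw [div_lt_one (by positivity)]
      have : (0 : ℝ) ≤ j := by positivity
      linarith
    simp only [hρdef]; linarith
  have hρ1 : ∀ j, ρ j < 1 := fun j => by
    have : 0 < 1 / ((j : ℝ) + 2) := by positivity
    simp only [hρdef]; linarith
  have hρlim : Tendsto ρ atTop (𝓝 1) := by
    have h1 : Tendsto (fun j : ℕ => 1 / ((j : ℝ) + 2)) atTop (𝓝 0) :=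
      tendsto_const_nhds.div_atTop
        (tendsto_atTop_add_const_right _ _ tendsto_natCast_atTop_atTop)
    simpa only [sub_zero] using h1.const_sub 1
  have hdiff : ∀ j, DifferentiableOn ℂ (fun z => f (dilate m n (ρ j) z))
      (hartogsTriangle ((m : ℝ) / n)) := fun j =>
    hf.1.comp (by unfold dilate; fun_prop) fun z hz => dilate_mem hm hn (hρ0 j) (hρ1 j) hz
  have hmeas : ∀ j, AEStronglyMeasurable (fun z => f (dilate m n (ρ j) z))
      (volume.restrict (hartogsTriangle ((m : ℝ) / n))) := fun j =>
    (hdiff j).continuousOn.aestronglyMeasurable hO.measurableSet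
  have hp := hpp.pos
  refine ⟨fun j z => f (dilate m n (ρ j) z), fun j => ⟨hdiff j, ?_⟩, ?_⟩
  · obtain ⟨C, hC⟩ := exists_norm_subBergman_le hm hn hr hk0 hk (hρ0 j) (hρ1 j)
    refine (memLp_fiberRadius_zpow hm hn (by linarith) hkr).of_le_mul
      (c := C * ρ j ^ k * ∫ w in hartogsTriangle ((m : ℝ) / n), ‖fiberRadius m w ^ k • f w‖)
      (hmeas j) ?_
    refine (ae_restrict_iff' hO.measurableSet).2 (Eventually.of_forall fun z hz => ?_)
    obtain ⟨hz0, hz1, hz2⟩ := (mem_hartogsTriangle_iff hm hn).1 hz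
    have hdz := dilate_mem hm hn (hρ0 j) (hρ1 j) hz
    have hb := hC f hw _ hdz
      (by rw [fiberRadius_dilate hm n (hρ0 j)]; exact mul_le_of_le_one_right (hρ0 j).le hz1.le)
      (by rw [baseRadius_dilate hm n (hρ0 j)]; exact mul_le_of_le_one_right (hρ0 j).le hz2.le)
    rw [h _ hdz, fiberRadius_dilate hm n (hρ0 j), mul_zpow] at hb
    rw [Real.norm_of_nonneg (by positivity : (0 : ℝ) ≤ fiberRadius m z ^ k)]
    exact hb.trans (le_of_eq (by ring))
  · have hfin := hf.2.2
    rw [eLpNorm_lt_top_iff_lintegral_rpow_enorm_lt_top (by simpa using hp) ENNReal.ofReal_ne_top,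
      ENNReal.toReal_ofReal hp.le] at hfin
    have hpt : ∀ᵐ z ∂volume.restrict (hartogsTriangle ((m : ℝ) / n)),
        Tendsto (fun j => f (dilate m n (ρ j) z)) atTop (𝓝 (f z)) := by
      refine (ae_restrict_iff' hO.measurableSet).2 (Eventually.of_forall fun z hz => ?_)
      have h1 : Tendsto (fun j => dilate m n (ρ j) z) atTop (𝓝 (dilate m n 1 z)) :=
        ((continuous_dilate m n).comp (Continuous.prodMk_left z)).tendsto 1 |>.comp hρlim
      rw [show dilate m n 1 z = z by simp [dilate]] at h1
      exact ((hf.1.continuousOn.continuousAt (hO.mem_nhds hz)).tendsto).comp h1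
    have hlim := tendsto_lintegral_enorm_sub_rpow hpp.lt.le hf.2.1 hmeas hfin.ne hpt
      (tendsto_dilateFactor m n hρlim)
      fun j => lintegral_dilate_le hm hn (hρ0 j) (hρ1 j) hf.1.continuousOn hp
    have hlim' := (ENNReal.continuous_rpow_const (y := 1 / p)).tendsto 0 |>.comp hlim
    rw [ENNReal.zero_rpow_of_pos (by positivity)] at hlim'
    refine hlim'.congr fun j => ?_
    rw [eLpNorm_eq_lintegral_rpow_enorm_toReal (by simpa using hp) ENNReal.ofReal_ne_top,
      ENNReal.toReal_ofReal hp.le]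
    rfl

/-- If the `L^r`-allowable multi-indices are those of weight at least `k`, and `|v| ^ k` belongs to
`L^{p'}`, then the closure of `A^r` in `A^p` is the set of fixed points of the sub-Bergman
projection. -/
theorem approxByBergman_iff_subBergman_eq (hm : 0 < m) (hn : 0 < n) (hpp : p.HolderConjugate p')
    (hpr : p < r) (hr : 2 ≤ r) (hk0 : k ≤ 0) (hk : r * (k - 1) + 2 * n + 2 * m ≤ 0)
    (hkr : 0 < r * k + 2 * n + 2 * m) (hkp : 0 < p' * k + 2 * n + 2 * m)
    (hf : f ∈ bergmanSpace (hartogsTriangle ((m : ℝ) / n)) p) :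
    SubBergmanConverges (hartogsTriangle ((m : ℝ) / n)) r f ∧
      (ApproxByBergman (hartogsTriangle ((m : ℝ) / n)) p r f ↔
        ∀ z ∈ hartogsTriangle ((m : ℝ) / n),
          subBergman (hartogsTriangle ((m : ℝ) / n)) r f z = f z) :=
  ⟨⟨fun _ hz _ hw => summable_subBergmanTerm hm hn hr hk0 hk hz hw, fun _ hz =>
      integrableOn_subBergmanKernel_mul hm hn hr hk0 hk hf.2.1
        (integrableOn_fiberRadius_zpow_smul hm hn hpp hkp hf.2) hz⟩,
    subBergman_eq_of_approx hm hn hpp hpr hr hk0 hk hkp hf,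
    approx_of_subBergman_eq hm hn hpp hr hk0 hk hkr hkp hf⟩

/-! ### Thresholds and the choice of $k$ -/

theorem threshold_le_iff (hr : 0 ≤ r) (hk : k ≤ 0) :
    threshold m n k ≤ ENNReal.ofReal r ↔ 2 * (m : ℝ) + 2 * n ≤ r * (1 - k) := by
  have h1 : (0 : ℝ) < 1 - k := by
    have : (k : ℝ) ≤ 0 := by exact_mod_cast hk
    linarith
  rw [threshold, ← ENNReal.ofReal_div_of_pos h1, ENNReal.ofReal_le_ofReal_iff hr, div_le_iff₀ h1]

/-- For $k<0$ this is the definition of $p_{k+1}$ with the denominator cleared. For $k=0$ the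
threshold is infinite and gives no information, but the claim is just $2n+2m>0$. -/
theorem lt_threshold_succ (hm : 0 < m) (hr : 0 ≤ r) (hk : k ≤ 0)
    (h : ENNReal.ofReal r < threshold m n (k + 1)) : 0 < r * k + 2 * n + 2 * m := by
  have hm' : (0 : ℝ) < m := by exact_mod_cast hm
  rcases hk.lt_or_eq with hk1 | rfl
  · rw [← not_le, threshold_le_iff hr (by omega)] at h
    push_cast at h
    linarith
  · simp only [Int.cast_zero, mul_zero, zero_add]
    positivity

end Main

theorem propositionT (m n : ℕ) (hm : 0 < m) (hn : 0 < n) (hmn : Nat.Coprime m n) :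
    (∀ p r : ℝ, 2 ≤ p → p < r →
      ∀ f ∈ bergmanSpace (hartogsTriangle ((m : ℝ) / (n : ℝ))) p,
        SubBergmanConverges (hartogsTriangle ((m : ℝ) / (n : ℝ))) r f ∧
        (ApproxByBergman (hartogsTriangle ((m : ℝ) / (n : ℝ))) p r f ↔
          ∀ z ∈ hartogsTriangle ((m : ℝ) / (n : ℝ)),
            subBergman (hartogsTriangle ((m : ℝ) / (n : ℝ))) r f z = f z)) ∧
    (∀ p p' : ℝ, 1 < p → p < 2 → p.HolderConjugate p' →
      ∀ k : ℤ, 1 - 2 * (m : ℤ) - 2 * (n : ℤ) ≤ k → k ≤ 0 →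
        ENNReal.ofReal p' < threshold m n (k + 1) →
      ∀ r : ℝ, threshold m n k ≤ ENNReal.ofReal r →
        ENNReal.ofReal r < threshold m n (k + 1) →
      ∀ f ∈ bergmanSpace (hartogsTriangle ((m : ℝ) / (n : ℝ))) p,
        SubBergmanConverges (hartogsTriangle ((m : ℝ) / (n : ℝ))) r f ∧
        (ApproxByBergman (hartogsTriangle ((m : ℝ) / (n : ℝ))) p r f ↔
          ∀ z ∈ hartogsTriangle ((m : ℝ) / (n : ℝ)),
            subBergman (hartogsTriangle ((m : ℝ) / (n : ℝ))) r f z = f z)) := by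
  have hm' : (0 : ℝ) < m := by exact_mod_cast hm
  have hn' : (0 : ℝ) < n := by exact_mod_cast hn
  constructor
  · intro p r hp hpr f hf
    have hr : 0 < r := by linarith
    have hpp := Real.HolderConjugate.conjExponent (p := p) (by linarith)
    have hq2 : p.conjExponent ≤ 2 := by
      rw [Real.conjExponent, div_le_iff₀ (by linarith)]; linarith
    -- The integer $\lfloor t\rfloor+1$ is the least one exceeding $t$, that is, the least $k$ with
    -- $rk+2n+2m>0$.
    set t : ℝ := -(2 * n + 2 * m) / r with ht
    have htr : r * t = -(2 * n + 2 * m) := by rw [ht]; field_simp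
    have ht0 : t < 0 := by rw [ht]; exact div_neg_of_neg_of_pos (by linarith) hr
    have hfl := Int.floor_le t
    have hfl' := Int.lt_floor_add_one t
    have hk0 : ⌊t⌋ + 1 ≤ 0 := by
      have : ⌊t⌋ < 0 := Int.floor_lt.2 (by simpa using ht0)
      omega
    have hkr : 0 < r * ((⌊t⌋ + 1 : ℤ) : ℝ) + 2 * n + 2 * m := by
      push_cast
      have := mul_lt_mul_of_pos_left hfl' hr
      linarith
    refine approxByBergman_iff_subBergman_eq (k := ⌊t⌋ + 1) hm hn hpp hpr (by linarith) hk0 ?_ hkr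
      ?_ hf
    · push_cast
      have := mul_le_mul_of_nonneg_left hfl hr.le
      rw [add_sub_cancel_right]
      linarith
    -- Since $p'\le2\le r$ and $k\le0$, one has $p'k\ge rk$, so integrability in $L^{p'}$ follows
    -- from that in $L^r$.
    · have hk0' : ((⌊t⌋ + 1 : ℤ) : ℝ) ≤ 0 := by exact_mod_cast hk0
      have := mul_le_mul_of_nonpos_right (show p.conjExponent ≤ r by linarith) hk0'
      linarith
  · intro p p' hp1 hp2 hpp k _ hk0 hkp r hrk hkr f hf
    have hp'2 : 2 < p' := by
      rw [hpp.conjugate_eq, lt_div_iff₀ (by linarith)]; linarith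
    have hp'k := lt_threshold_succ hm (by linarith) hk0 hkp
    have hk0' : (k : ℝ) ≤ 0 := by exact_mod_cast hk0
    -- From $p'>2$ and $k\le0$, $2k+2n+2m\ge p'k+2n+2m>0$.
    have hkmn : 0 < k + n + m := by
      have h := mul_le_mul_of_nonpos_right hp'2.le hk0'
      have h2 : (0 : ℝ) < k + n + m := by linarith
      exact_mod_cast h2
    -- As $k+n+m$ is a positive integer, $1-k\le m+n$, hence $r\ge p_k\ge2$.
    have hr2 : 2 ≤ r := by
      have h1k : (0 : ℝ) < 1 - k := by linarith
      have h2 : (1 : ℝ) ≤ k + n + m := by exact_mod_cast hkmn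
      have h3 := hrk
      rw [threshold, ← ENNReal.ofReal_div_of_pos h1k] at h3
      have h4 : 2 ≤ (2 * (m : ℝ) + 2 * n) / (1 - k) := by rw [le_div_iff₀ h1k]; linarith
      have h5 := (ENNReal.ofReal_le_ofReal_iff' (p := (2 * (m : ℝ) + 2 * n) / (1 - k)) (q := r)).1
        h3
      rcases h5 with h5 | h5 <;> linarith
    have hkk := (threshold_le_iff (by linarith) hk0).1 hrk
    exact approxByBergman_iff_subBergman_eq hm hn hpp (by linarith) hr2 hk0 (by linarith)
      (lt_threshold_succ hm (by linarith) hk0 hkr) hp'k hf
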